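/- Let $k$ be a field and let $\mathcal C$ be a braided monoidal category, with braiding $\Psi$, whose objects have underlying $k$-vector spaces compatibly with tensor products: there is a strong monoidal functor from $\mathcal C$ to $k$-vector spaces, which need not preserve the braiding (for example, the modules over a quasitriangular Hopf algebra, or the comodules over a coquasitriangular one). Let $X$ be a finite-dimensional braided Hopf algebra, that is, a Hopf algebra object in $\mathcal C$ that has a dual object $D$ with evaluation $\langle\cdot,\cdot\rangle: D\otimes X\to k$ and canonical element $\sum_i\phi^i\otimes\epsilon_i\in X\otimes D$, both morphisms of $\mathcal C$. Let $D$ be a braided Hopf algebra with invertible antipode $S$, dual to $X$ in the sense that $$\langle\sigma\tau,\xi\rangle=\langle\sigma,\xi_{(2)}\rangle\langle\tau,\xi_{(1)}\rangle,\quad \langle\sigma,\xi\eta\rangle=\langle\sigma_{(1)},\eta\rangle\langle\sigma_{(2)},\xi\rangle,\quad \langle 1,\xi\rangle=\epsilon(\xi),\quad \langle\sigma,1\rangle=\epsilon(\sigma).$$ Write $\sum_i\epsilon_i'\otimes\phi_i'=\Psi_{D,X}^{-1}\big(\sum_i\phi^i\otimes\epsilon_i\big)\in D\otimes X$ for the image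 of the canonical element under the inverse of $\Psi_{D,X}:D\otimes X\to X\otimes D$, and define the braided integral $I:X\to X$ by the braided modified trace formula $$I(\xi)=\sum_i\big\langle S^{-2}(\epsilon_i'),(\phi_i'\xi)_{(1)}\big\rangle\,(\phi_i'\xi)_{(2)} .$$ Then $I$ is nontrivial, i.e. $I\neq0$ on the underlying vector space of $X$. Moreover $I$ takes values in the multiples of a right delta function: there are a nonzero right invariant integral $R:D\to k$ (that is, $R$ is linear and $R(\sigma_{(1)})\sigma_{(2)}=R(\sigma)1_D$), the element $\delta^R_X\in X$ with $\langle\sigma,\delta^R_X\rangle=R(\sigma)$ for all $\sigma\in D$, and a nonzero left invariant integral $L:X\to k$ (that is, $L$ is linear and $\xi_{(1)}L(\xi_{(2)})=L(\xi)1_X$) such that $I(\xi)=L(\xi)\,\delta^R_X$ for all $\xi\in X$. -/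

import Mathlib

open CategoryTheory MonoidalCategory
open scoped MonObj ComonObj HopfObj TensorProduct

universe u v w

namespace BraidedIntegral

section Diagrams

variable {C : Type w} [Category.{v} C] [MonoidalCategory C]

/-- The nested pairing `(σ ⊗ τ) ⊗ (x ⊗ y) ↦ ⟨σ, y⟩ ⟨τ, x⟩` of `D ⊗ D` with `X ⊗ X`. -/
def nestedEval (X D : C) [ExactPairing X D] : (D ⊗ D) ⊗ (X ⊗ X) ⟶ 𝟙_ C :=
  (α_ D D (X ⊗ X)).hom ≫ D ◁ (α_ D X X).inv ≫ D ◁ (ε_ X D ▷ X) ≫ D ◁ (λ_ X).hom ≫ ε_ X D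

/-- The action `σ ⊗ x ↦ ⟨σ, x₍₁₎⟩ x₍₂₎` of `D` on `X`. -/
def action (X D : C) [ComonObj X] [ExactPairing X D] : D ⊗ X ⟶ X :=
  D ◁ Δ[X] ≫ (α_ D X X).inv ≫ ε_ X D ▷ X ≫ (λ_ X).hom

variable [BraidedCategory C]

/-- Hopf objects `X` and `D` in a braided category, in exact duality as objects (evaluation
`D ⊗ X ⟶ 𝟙`, canonical element `𝟙 ⟶ X ⊗ D`), are dual as braided Hopf algebras: the product of
each is paired with the coproduct of the other, without any crossing, so
`⟨σ τ, x⟩ = ⟨σ, x₍₂₎⟩ ⟨τ, x₍₁₎⟩` and `⟨σ, x y⟩ = ⟨σ₍₁₎, y⟩ ⟨σ₍₂₎, x⟩`. -/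
structure IsHopfDual (X D : C) [HopfObj X] [HopfObj D] [ExactPairing X D] : Prop where
  mul_pair : μ[D] ▷ X ≫ ε_ X D = (D ⊗ D) ◁ Δ[X] ≫ nestedEval X D
  pair_mul : D ◁ μ[X] ≫ ε_ X D = Δ[D] ▷ (X ⊗ X) ≫ nestedEval X D
  one_pair : η[D] ▷ X ≫ ε_ X D = (λ_ X).hom ≫ ε[X]
  pair_one : D ◁ η[X] ≫ ε_ X D = (ρ_ D).hom ≫ ε[D]

/-- The canonical element of `X ⊗ D` moved to `D ⊗ X` by the inverse of the braiding
`D ⊗ X ⟶ X ⊗ D`. -/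
def twistedCoev (X D : C) [ExactPairing X D] : 𝟙_ C ⟶ D ⊗ X :=
  η_ X D ≫ (β_ D X).inv

/-- The braided integral, given by the braided modified trace formula: if `∑ ε' ⊗ φ' ∈ D ⊗ X` is
the image of the canonical element under the inverse braiding, then `x` is sent to
`∑ ⟨S⁻² ε', (φ' x)₍₁₎⟩ (φ' x)₍₂₎`. -/
noncomputable def braidedIntegral (X D : C) [HopfObj X] [HopfObj D] [ExactPairing X D]
    [IsIso 𝒮[D]] : X ⟶ X :=
  (λ_ X).inv ≫ twistedCoev X D ▷ X ≫ (α_ D X X).hom ≫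
    inv (𝒮[D] ≫ 𝒮[D]) ▷ (X ⊗ X) ≫ D ◁ μ[X] ≫ action X D

end Diagrams

section Underlying

variable {k : Type u} [Field k] {C : Type w} [Category.{v} C] [MonoidalCategory C]
  (F : C ⥤ ModuleCat.{u} k) [F.Monoidal]

/-- The coproduct on the underlying vector space. -/
def comulLin (X : C) [ComonObj X] : F.obj X →ₗ[k] F.obj X ⊗[k] F.obj X :=
  (F.map Δ[X] ≫ Functor.OplaxMonoidal.δ F X X).hom

/-- The unit element of the underlying vector space. -/
def oneElt (X : C) [MonObj X] : F.obj X :=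
  (Functor.LaxMonoidal.ε F ≫ F.map η[X]).hom (1 : k)

/-- The pairing `⟨σ, x⟩` on the underlying vector spaces. -/
def pairing (X D : C) [ExactPairing X D] : F.obj D →ₗ[k] F.obj X →ₗ[k] k :=
  TensorProduct.curry
    (Functor.LaxMonoidal.μ F D X ≫ F.map (ε_ X D) ≫ Functor.OplaxMonoidal.η F).hom

/-- A (numerical) left invariant integral on `X`: `x₍₁₎ L(x₍₂₎) = L(x) 1`. -/
def IsLeftIntegral (X : C) [MonObj X] [ComonObj X] (L : F.obj X →ₗ[k] k) : Prop :=
  ∀ x : F.obj X,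
    TensorProduct.rid k (F.obj X) (L.lTensor (F.obj X) (comulLin F X x)) = L x • oneElt F X

/-- A (numerical) right invariant integral on `D`: `R(σ₍₁₎) σ₍₂₎ = R(σ) 1`. -/
def IsRightIntegral (D : C) [MonObj D] [ComonObj D] (R : F.obj D →ₗ[k] k) : Prop :=
  ∀ s : F.obj D,
    TensorProduct.lid k (F.obj D) (R.rTensor (F.obj D) (comulLin F D s)) = R s • oneElt F D

/-- `δ ∈ X` is the right delta function that implements the nonzero right invariant integral
`R` on the dual `D`: `⟨σ, δ⟩ = R(σ)`. -/
def IsRightDelta (X D : C) [ExactPairing X D] [MonObj D] [ComonObj D]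
    (R : F.obj D →ₗ[k] k) (δ : F.obj X) : Prop :=
  IsRightIntegral F D R ∧ R ≠ 0 ∧ ∀ s : F.obj D, pairing F X D s δ = R s

end Underlying

end BraidedIntegral

/-! The argument is the fundamental theorem of Hopf modules, applied to `X` over `D`. `D` acts on
`X` by σ ▷ x = ⟨σ, x₍₁₎⟩ x₍₂₎ and coacts by `coaction`, the transpose of left multiplication;
`action_coaction` is their compatibility. In these terms `I` is x ↦ S⁻²(x₍₁₎) ▷ x₍₀₎
(`st_braidedIntegral`), up to an inverse crossing. This is a map onto coinvariants
(`braidedIntegral_coaction`), and x = S⁻¹(x₍₁₎) ▷ I(x₍₀₎) (`eq_coaction_integral_action`).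

Hence σ ⊗ I(y) ↦ σ ▷ I(y) identifies D ⊗ im I with X (`exists_section`). On vector spaces dim D =
dim X > 0, so im I is a line spanned by some δ, and I = L(·)δ with L ≠ 0. Since I(σ ▷ x) = ε(σ)I(x)
(`action_integral`), L is a left integral on X; since x I(y) = ε(x)I(y) (`mul_integral`), pairing
with δ is a right integral on D.

The braided identities are proved in the category. The functor only sees identities built from
tensor products, the action, the multiplication, `I` and a section θ, so it need not preserve the
braiding. String diagrams are encoded as operations on the leading factors of a right-nested product
with arbitrary tail `T`, so associators stay out of the computations. -/

namespace BraidedIntegral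

section Stack

variable {C : Type w} [Category.{v} C] [MonoidalCategory C]

/-! ### Morphisms acting on the leading factors of a right-nested tensor product -/

/-- A morphism `𝟙 ⟶ A` inserting a leading factor. -/
def st01 {A : C} (f : 𝟙_ C ⟶ A) (T : C) : T ⟶ A ⊗ T := (λ_ T).inv ≫ f ▷ T

/-- A morphism `𝟙 ⟶ A ⊗ B` inserting two leading factors. -/
def st02 {A B : C} (f : 𝟙_ C ⟶ A ⊗ B) (T : C) : T ⟶ A ⊗ B ⊗ T :=
  (λ_ T).inv ≫ f ▷ T ≫ (α_ A B T).hom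

/-- A morphism `A ⟶ 𝟙` removing the leading factor. -/
def st10 {A : C} (f : A ⟶ 𝟙_ C) (T : C) : A ⊗ T ⟶ T := f ▷ T ≫ (λ_ T).hom

/-- A morphism `A ⟶ B` applied to the leading factor. -/
def st11 {A B : C} (f : A ⟶ B) (T : C) : A ⊗ T ⟶ B ⊗ T := f ▷ T

/-- A morphism `A ⟶ B ⊗ B'` splitting the leading factor. -/
def st12 {A B B' : C} (f : A ⟶ B ⊗ B') (T : C) : A ⊗ T ⟶ B ⊗ B' ⊗ T :=
  f ▷ T ≫ (α_ B B' T).hom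

/-- A morphism `A ⊗ B ⟶ 𝟙` removing the two leading factors. -/
def st20 {A B : C} (f : A ⊗ B ⟶ 𝟙_ C) (T : C) : A ⊗ B ⊗ T ⟶ T :=
  (α_ A B T).inv ≫ f ▷ T ≫ (λ_ T).hom

/-- A morphism `A ⊗ A' ⟶ B` merging the two leading factors. -/
def st21 {A A' B : C} (f : A ⊗ A' ⟶ B) (T : C) : A ⊗ A' ⊗ T ⟶ B ⊗ T :=
  (α_ A A' T).inv ≫ f ▷ T

/-- A morphism `A ⊗ A' ⟶ B ⊗ B'` applied to the two leading factors. -/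
def st22 {A A' B B' : C} (f : A ⊗ A' ⟶ B ⊗ B') (T : C) : A ⊗ A' ⊗ T ⟶ B ⊗ B' ⊗ T :=
  (α_ A A' T).inv ≫ f ▷ T ≫ (α_ B B' T).hom

variable {A A' B B' T U : C} (g : T ⟶ U)

/-- The interchange law: operations on disjoint strands commute. This and its analogues below are
the height changes of string diagrams. -/
lemma st01_nat (f : 𝟙_ C ⟶ A) : st01 f T ≫ A ◁ g = g ≫ st01 f U := by
  simp [st01, ← whisker_exchange]

lemma st02_nat (f : 𝟙_ C ⟶ A ⊗ B) : st02 f T ≫ A ◁ B ◁ g = g ≫ st02 f U := by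
  have h := whisker_exchange f g
  simp only [tensor_whiskerLeft] at h
  simp [st02, ← cancel_mono (α_ A B U).inv, ← h]

lemma st10_nat (f : A ⟶ 𝟙_ C) : st10 f T ≫ g = A ◁ g ≫ st10 f U := by
  simp [st10, whisker_exchange_assoc]

lemma st11_nat (f : A ⟶ B) : st11 f T ≫ B ◁ g = A ◁ g ≫ st11 f U := by
  simp [st11, whisker_exchange]

lemma st12_nat (f : A ⟶ B ⊗ B') : st12 f T ≫ B ◁ B' ◁ g = A ◁ g ≫ st12 f U := by
  simp [st12, whisker_exchange_assoc]

lemma st20_nat (f : A ⊗ B ⟶ 𝟙_ C) : st20 f T ≫ g = A ◁ B ◁ g ≫ st20 f U := by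
  simp only [st20, Category.assoc, ← leftUnitor_naturality, ← whisker_exchange_assoc,
    tensor_whiskerLeft, Iso.inv_hom_id_assoc]

lemma st21_nat (f : A ⊗ A' ⟶ B) : st21 f T ≫ B ◁ g = A ◁ A' ◁ g ≫ st21 f U := by
  simp [st21, ← whisker_exchange]

lemma st22_nat (f : A ⊗ A' ⟶ B ⊗ B') :
    st22 f T ≫ B ◁ B' ◁ g = A ◁ A' ◁ g ≫ st22 f U := by
  have h := whisker_exchange f g
  simp only [tensor_whiskerLeft, Category.assoc] at h
  simp only [st22, Category.assoc, Iso.inv_hom_id_assoc,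
    ← cancel_mono (α_ B B' U).inv, Iso.hom_inv_id, Category.comp_id, ← h]

variable [BraidedCategory C]

/-- The braiding of the two leading factors. -/
def br (A B T : C) : A ⊗ B ⊗ T ⟶ B ⊗ A ⊗ T := st22 (β_ A B).hom T

/-- The inverse braiding of the two leading factors. -/
def bi (A B T : C) : B ⊗ A ⊗ T ⟶ A ⊗ B ⊗ T := st22 (β_ A B).inv T

lemma br_nat (A B : C) : br A B T ≫ B ◁ A ◁ g = A ◁ B ◁ g ≫ br A B U := st22_nat g _

lemma bi_nat (A B : C) : bi A B T ≫ A ◁ B ◁ g = B ◁ A ◁ g ≫ bi A B U := st22_nat g _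

@[simp]
lemma br_bi (A B T : C) : br A B T ≫ bi A B T = 𝟙 _ := by
  simp [br, bi, st22, ← comp_whiskerRight_assoc]

@[simp]
lemma br_bi_assoc (A B T : C) {Z : C} (z : _ ⟶ Z) :
    br A B T ≫ bi A B T ≫ z = z := by
  rw [reassoc_of% br_bi]

@[simp]
lemma bi_br (A B T : C) : bi A B T ≫ br A B T = 𝟙 _ := by
  simp [br, bi, st22, ← comp_whiskerRight_assoc]

@[simp]
lemma bi_br_assoc (A B T : C) {Z : C} (z : _ ⟶ Z) :
    bi A B T ≫ br A B T ≫ z = z := by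
  rw [reassoc_of% bi_br]

@[simp]
lemma whisker_br_bi (E A B T : C) : E ◁ br A B T ≫ E ◁ bi A B T = 𝟙 _ := by
  simp [← whiskerLeft_comp]

@[simp]
lemma whisker_br_bi_assoc (E A B T : C) {Z : C} (z : _ ⟶ Z) :
    E ◁ br A B T ≫ E ◁ bi A B T ≫ z = z := by
  rw [reassoc_of% whisker_br_bi]

@[simp]
lemma whisker_bi_br (E A B T : C) : E ◁ bi A B T ≫ E ◁ br A B T = 𝟙 _ := by
  simp [← whiskerLeft_comp]

@[simp]
lemma whisker_bi_br_assoc (E A B T : C) {Z : C} (z : _ ⟶ Z) :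
    E ◁ bi A B T ≫ E ◁ br A B T ≫ z = z := by
  rw [reassoc_of% whisker_bi_br]

/-! ### Sliding a strand across the crossings -/

variable (T) (E : C)

/-- Naturality of the braiding, combined with the hexagon or unit laws when `f` has several legs or
none; `monoidal` absorbs the coherence. In this family "left" and "right" name the side of the
positive crossing on which `f` enters, and the `bi` versions follow by composing with inverse
crossings. -/
lemma br_left01 (f : 𝟙_ C ⟶ A) :
    st01 f (E ⊗ T) ≫ br A E T =
      E ◁ st01 f T := by
  have h := BraidedCategory.braiding_naturality_left f E
  rw [braiding_tensorUnit_left] at h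
  have h' := congrArg (fun k => ((λ_ (E ⊗ T)).inv ≫ (α_ (𝟙_ C) E T).inv) ≫ k ▷ T ≫ (α_ E A T).hom) h
  simp only [comp_whiskerRight, Category.assoc] at h'
  simp only [br, st22, st01]
  convert h' using 1 <;> monoidal

lemma br_right01 (f : 𝟙_ C ⟶ A) :
    E ◁ st01 f T ≫ br E A T =
      st01 f (E ⊗ T) := by
  have h := BraidedCategory.braiding_naturality_right E f
  rw [braiding_tensorUnit_right] at h
  have h' := congrArg (fun k => (E ◁ (λ_ T).inv ≫ (α_ E (𝟙_ C) T).inv) ≫ k ▷ T ≫ (α_ A E T).hom) h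
  simp only [comp_whiskerRight, Category.assoc] at h'
  simp only [br, st22, st01]
  convert h' using 1 <;> monoidal

lemma bi_left01 (f : 𝟙_ C ⟶ A) :
    E ◁ st01 f T ≫ bi A E T =
      st01 f (E ⊗ T) := by
  have h := br_left01 T E f
  simpa using congrArg (fun k => k ≫ (bi A E T)) h.symm

lemma bi_right01 (f : 𝟙_ C ⟶ A) :
    st01 f (E ⊗ T) ≫ bi E A T =
      E ◁ st01 f T := by
  have h := br_right01 T E f
  simpa using congrArg (fun k => k ≫ (bi E A T)) h.symm

lemma br_left02 (f : 𝟙_ C ⟶ A ⊗ B) :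
    st02 f (E ⊗ T) ≫ A ◁ br B E T ≫ br A E (B ⊗ T) =
      E ◁ st02 f T := by
  have h := BraidedCategory.braiding_naturality_left f E
  rw [braiding_tensorUnit_left, BraidedCategory.braiding_tensor_left_hom] at h
  have h' := congrArg (fun k => ((λ_ (E ⊗ T)).inv ≫ (α_ (𝟙_ C) E T).inv) ≫ k ▷ T ≫
    (α_ E (A ⊗ B) T).hom ≫ E ◁ (α_ A B T).hom) h
  simp only [comp_whiskerRight, Category.assoc] at h'
  simp only [br, st22, st02, Category.assoc]
  convert h' using 1 <;> monoidal

lemma br_right02 (f : 𝟙_ C ⟶ A ⊗ B) :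
    E ◁ st02 f T ≫ br E A (B ⊗ T) ≫ A ◁ br E B T =
      st02 f (E ⊗ T) := by
  have h := BraidedCategory.braiding_naturality_right E f
  rw [braiding_tensorUnit_right, BraidedCategory.braiding_tensor_right_hom] at h
  have h' := congrArg (fun k => (E ◁ (λ_ T).inv ≫ (α_ E (𝟙_ C) T).inv) ≫ k ▷ T ≫
    (α_ (A ⊗ B) E T).hom ≫ (α_ A B (E ⊗ T)).hom) h
  simp only [comp_whiskerRight, Category.assoc] at h'
  simp only [br, st22, st02, Category.assoc]
  convert h' using 1 <;> monoidal

lemma br_left10 (f : A ⟶ 𝟙_ C) :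
    st10 f (E ⊗ T) =
      br A E T ≫ E ◁ st10 f T := by
  have h := BraidedCategory.braiding_naturality_left f E
  rw [braiding_tensorUnit_left] at h
  have h' := congrArg (fun k => (α_ A E T).inv ≫ k ▷ T ≫ (α_ E (𝟙_ C) T).hom ≫ E ◁ (λ_ T).hom) h
  simp only [comp_whiskerRight, Category.assoc] at h'
  simp only [br, st22, st10, Category.assoc]
  convert h' using 1 <;> monoidal

lemma br_right10 (f : A ⟶ 𝟙_ C) :
    E ◁ st10 f T =
      br E A T ≫ st10 f (E ⊗ T) := by
  have h := BraidedCategory.braiding_naturality_right E f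
  rw [braiding_tensorUnit_right] at h
  have h' := congrArg (fun k => ((α_ E A T).inv) ≫ k ▷ T ≫ (α_ (𝟙_ C) E T).hom ≫ (λ_ (E ⊗ T)).hom) h
  simp only [comp_whiskerRight, Category.assoc] at h'
  simp only [br, st22, st10, Category.assoc]
  convert h' using 1 <;> monoidal

lemma bi_right10 (f : A ⟶ 𝟙_ C) :
    st10 f (E ⊗ T) =
      bi E A T ≫ E ◁ st10 f T := by
  have h := br_right10 T E f
  simpa using congrArg (fun k => (bi E A T) ≫ k) h.symm

lemma br_left11 (f : A ⟶ B) :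
    st11 f (E ⊗ T) ≫ br B E T =
      br A E T ≫ E ◁ st11 f T := by
  have h := BraidedCategory.braiding_naturality_left f E
  have h' := congrArg (fun k => (α_ A E T).inv ≫ k ▷ T ≫ (α_ E B T).hom) h
  simp only [comp_whiskerRight, Category.assoc] at h'
  simp only [br, st22, st11, Category.assoc]
  convert h' using 1 <;> monoidal

lemma br_right11 (f : A ⟶ B) :
    E ◁ st11 f T ≫ br E B T =
      br E A T ≫ st11 f (E ⊗ T) := by
  have h := BraidedCategory.braiding_naturality_right E f
  have h' := congrArg (fun k => ((α_ E A T).inv) ≫ k ▷ T ≫ (α_ B E T).hom) h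
  simp only [comp_whiskerRight, Category.assoc] at h'
  simp only [br, st22, st11, Category.assoc]
  convert h' using 1 <;> monoidal

lemma bi_left11 (f : A ⟶ B) :
    E ◁ st11 f T ≫ bi B E T =
      bi A E T ≫ st11 f (E ⊗ T) := by
  have h := br_left11 T E f
  simpa using congrArg (fun k => (bi A E T) ≫ k ≫ (bi B E T)) h.symm

lemma bi_right11 (f : A ⟶ B) :
    st11 f (E ⊗ T) ≫ bi E B T =
      bi E A T ≫ E ◁ st11 f T := by
  have h := br_right11 T E f
  simpa using congrArg (fun k => (bi E A T) ≫ k ≫ (bi E B T)) h.symm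

lemma br_left12 (f : A ⟶ B ⊗ B') :
    st12 f (E ⊗ T) ≫ B ◁ br B' E T ≫ br B E (B' ⊗ T) =
      br A E T ≫ E ◁ st12 f T := by
  have h := BraidedCategory.braiding_naturality_left f E
  rw [BraidedCategory.braiding_tensor_left_hom] at h
  have h' := congrArg (fun k => (α_ A E T).inv ≫ k ▷ T ≫ (α_ E (B ⊗ B') T).hom ≫
    E ◁ (α_ B B' T).hom) h
  simp only [comp_whiskerRight, Category.assoc] at h'
  simp only [br, st22, st12, Category.assoc]
  convert h' using 1 <;> monoidal

lemma br_right12 (f : A ⟶ B ⊗ B') :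
    E ◁ st12 f T ≫ br E B (B' ⊗ T) ≫ B ◁ br E B' T =
      br E A T ≫ st12 f (E ⊗ T) := by
  have h := BraidedCategory.braiding_naturality_right E f
  rw [BraidedCategory.braiding_tensor_right_hom] at h
  have h' := congrArg (fun k => ((α_ E A T).inv) ≫ k ▷ T ≫ (α_ (B ⊗ B') E T).hom ≫
    (α_ B B' (E ⊗ T)).hom) h
  simp only [comp_whiskerRight, Category.assoc] at h'
  simp only [br, st22, st12, Category.assoc]
  convert h' using 1 <;> monoidal

lemma bi_left12 (f : A ⟶ B ⊗ B') :
    E ◁ st12 f T ≫ bi B E (B' ⊗ T) ≫ B ◁ bi B' E T =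
      bi A E T ≫ st12 f (E ⊗ T) := by
  have h := br_left12 T E f
  simpa using congrArg (fun k => (bi A E T) ≫ k ≫ (bi B E (B' ⊗ T) ≫ B ◁ bi B' E T)) h.symm

lemma bi_right12 (f : A ⟶ B ⊗ B') :
    st12 f (E ⊗ T) ≫ B ◁ bi E B' T ≫ bi E B (B' ⊗ T) =
      bi E A T ≫ E ◁ st12 f T := by
  have h := br_right12 T E f
  simpa using congrArg (fun k => (bi E A T) ≫ k ≫ (B ◁ bi E B' T ≫ bi E B (B' ⊗ T))) h.symm

lemma br_left20 (f : A ⊗ B ⟶ 𝟙_ C) :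
    st20 f (E ⊗ T) =
      A ◁ br B E T ≫ br A E (B ⊗ T) ≫ E ◁ st20 f T := by
  have h := BraidedCategory.braiding_naturality_left f E
  rw [BraidedCategory.braiding_tensor_left_hom, braiding_tensorUnit_left] at h
  have h' := congrArg (fun k => ((α_ A B (E ⊗ T)).inv ≫ (α_ (A ⊗ B) E T).inv) ≫ k ▷ T ≫
    (α_ E (𝟙_ C) T).hom ≫ E ◁ (λ_ T).hom) h
  simp only [comp_whiskerRight, Category.assoc] at h'
  simp only [br, st22, st20, Category.assoc]
  convert h' using 1 <;> monoidal

lemma br_right20 (f : A ⊗ B ⟶ 𝟙_ C) :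
    E ◁ st20 f T =
      br E A (B ⊗ T) ≫ A ◁ br E B T ≫ st20 f (E ⊗ T) := by
  have h := BraidedCategory.braiding_naturality_right E f
  rw [BraidedCategory.braiding_tensor_right_hom, braiding_tensorUnit_right] at h
  have h' := congrArg (fun k => (E ◁ (α_ A B T).inv ≫ (α_ E (A ⊗ B) T).inv) ≫ k ▷ T ≫
    (α_ (𝟙_ C) E T).hom ≫ (λ_ (E ⊗ T)).hom) h
  simp only [comp_whiskerRight, Category.assoc] at h'
  simp only [br, st22, st20, Category.assoc]
  convert h' using 1 <;> monoidal

lemma br_left21 (f : A ⊗ A' ⟶ B) :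
    st21 f (E ⊗ T) ≫ br B E T =
      A ◁ br A' E T ≫ br A E (A' ⊗ T) ≫ E ◁ st21 f T := by
  have h := BraidedCategory.braiding_naturality_left f E
  rw [BraidedCategory.braiding_tensor_left_hom] at h
  have h' := congrArg (fun k => ((α_ A A' (E ⊗ T)).inv ≫ (α_ (A ⊗ A') E T).inv) ≫ k ▷ T ≫
    (α_ E B T).hom) h
  simp only [comp_whiskerRight, Category.assoc] at h'
  simp only [br, st22, st21, Category.assoc]
  convert h' using 1 <;> monoidal

lemma br_right21 (f : A ⊗ A' ⟶ B) :
    E ◁ st21 f T ≫ br E B T =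
      br E A (A' ⊗ T) ≫ A ◁ br E A' T ≫ st21 f (E ⊗ T) := by
  have h := BraidedCategory.braiding_naturality_right E f
  rw [BraidedCategory.braiding_tensor_right_hom] at h
  have h' := congrArg (fun k => (E ◁ (α_ A A' T).inv ≫ (α_ E (A ⊗ A') T).inv) ≫ k ▷ T ≫
    (α_ B E T).hom) h
  simp only [comp_whiskerRight, Category.assoc] at h'
  simp only [br, st22, st21, Category.assoc]
  convert h' using 1 <;> monoidal

lemma bi_left21 (f : A ⊗ A' ⟶ B) :
    E ◁ st21 f T ≫ bi B E T =
      bi A E (A' ⊗ T) ≫ A ◁ bi A' E T ≫ st21 f (E ⊗ T) := by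
  have h := br_left21 T E f
  simpa using congrArg (fun k => (bi A E (A' ⊗ T) ≫ A ◁ bi A' E T) ≫ k ≫ (bi B E T)) h.symm

lemma bi_right21 (f : A ⊗ A' ⟶ B) :
    st21 f (E ⊗ T) ≫ bi E B T =
      A ◁ bi E A' T ≫ bi E A (A' ⊗ T) ≫ E ◁ st21 f T := by
  have h := br_right21 T E f
  simpa using congrArg (fun k => (A ◁ bi E A' T ≫ bi E A (A' ⊗ T)) ≫ k ≫ (bi E B T)) h.symm

end Stack

section Laws

variable {C : Type w} [Category.{v} C] [MonoidalCategory C]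

/-! ### The axioms of monoids, comonoids and exact pairings on stacked tensor products -/

section

variable (A : C) [MonObj A] (T : C)

lemma st_mul_assoc : A ◁ st21 μ[A] T ≫ st21 μ[A] T = st21 μ[A] (A ⊗ T) ≫ st21 μ[A] T := by
  have h := congrArg (fun k => A ◁ (α_ A A T).inv ≫ (α_ A (A ⊗ A) T).inv ≫ (α_ A A A).inv ▷ T ≫
    k ▷ T) (MonObj.mul_assoc A)
  simp only [comp_whiskerRight] at h
  simp only [st21]
  convert h.symm using 1 <;> monoidal

lemma st_one_mul : st01 η[A] (A ⊗ T) ≫ st21 μ[A] T = 𝟙 _ := by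
  have h := congrArg (fun k => (λ_ (A ⊗ T)).inv ≫ (α_ (𝟙_ C) A T).inv ≫ k ▷ T) (MonObj.one_mul A)
  simp only [comp_whiskerRight] at h
  simp only [st21, st01]
  convert h using 1 <;> monoidal

end

section

variable (A : C) [ComonObj A] (T : C)

lemma st_comul_assoc : st12 Δ[A] T ≫ A ◁ st12 Δ[A] T = st12 Δ[A] T ≫ st12 Δ[A] (A ⊗ T) := by
  have h := congrArg (fun k => k ▷ T ≫ (α_ A (A ⊗ A) T).hom ≫ A ◁ (α_ A A T).hom)
    (ComonObj.comul_assoc A)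
  simp only [comp_whiskerRight] at h
  simp only [st12]
  convert h using 1 <;> monoidal

lemma st_counit_comul : st12 Δ[A] T ≫ st10 ε[A] (A ⊗ T) = 𝟙 _ := by
  have h := congrArg (fun k => k ▷ T ≫ (α_ (𝟙_ C) A T).hom ≫ (λ_ (A ⊗ T)).hom)
    (ComonObj.counit_comul A)
  simp only [comp_whiskerRight] at h
  simp only [st12, st10]
  convert h using 1 <;> monoidal

lemma st_comul_counit : st12 Δ[A] T ≫ A ◁ st10 ε[A] T = 𝟙 _ := by
  have h := congrArg (fun k => k ▷ T ≫ (α_ A (𝟙_ C) T).hom ≫ A ◁ (λ_ T).hom)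
    (ComonObj.comul_counit A)
  simp only [comp_whiskerRight] at h
  simp only [st12, st10]
  convert h using 1 <;> monoidal

end

section

variable (X D : C) [ExactPairing X D] (T : C)

lemma st_coev_ev : st02 (η_ X D) (X ⊗ T) ≫ X ◁ st20 (ε_ X D) T = 𝟙 _ := by
  have h := congrArg (fun k => (λ_ (X ⊗ T)).inv ≫ (α_ (𝟙_ C) X T).inv ≫ k ▷ T ≫
    (α_ X (𝟙_ C) T).hom ≫ X ◁ (λ_ T).hom) (ExactPairing.evaluation_coevaluation X D)
  simp only [comp_whiskerRight] at h
  simp only [st02, st20]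
  convert h using 1 <;> monoidal

lemma st_ev_coev : D ◁ st02 (η_ X D) T ≫ st20 (ε_ X D) (D ⊗ T) = 𝟙 _ := by
  have h := congrArg (fun k => D ◁ (λ_ T).inv ≫ (α_ D (𝟙_ C) T).inv ≫ k ▷ T ≫
    (α_ (𝟙_ C) D T).hom ≫ (λ_ (D ⊗ T)).hom) (ExactPairing.coevaluation_evaluation X D)
  simp only [comp_whiskerRight] at h
  simp only [st02, st20]
  convert h using 1 <;> monoidal

lemma st21_action [ComonObj X] :
    st21 (action X D) T = D ◁ st12 Δ[X] T ≫ st20 (ε_ X D) (X ⊗ T) := by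
  simp only [st21, st12, st20, action]
  monoidal

/-- A morphism into `X ⊗ U` is determined by its pairing with `D`. -/
lemma eq_of_ev {X D : C} [ExactPairing X D] {T U : C} {f g : T ⟶ X ⊗ U}
    (h : D ◁ f ≫ st20 (ε_ X D) U = D ◁ g ≫ st20 (ε_ X D) U) : f = g := by
  have key (f : T ⟶ X ⊗ U) : f = st02 (η_ X D) T ≫ X ◁ (D ◁ f ≫ st20 (ε_ X D) U) := by
    rw [whiskerLeft_comp, reassoc_of% st02_nat, st_coev_ev, Category.comp_id]
  rw [key f, key g, h]

end

variable [BraidedCategory C]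

section

variable (A A' E T : C)

lemma br_yang_baxter : br A A' (E ⊗ T) ≫ A' ◁ br A E T ≫ br A' E (A ⊗ T) =
    A ◁ br A' E T ≫ br A E (A' ⊗ T) ≫ E ◁ br A A' T := by
  have h := congrArg (fun k => A ◁ (α_ A' E T).inv ≫ (α_ A (A' ⊗ E) T).inv ≫ k ▷ T ≫
    (α_ E (A' ⊗ A) T).hom ≫ E ◁ (α_ A' A T).hom) (BraidedCategory.yang_baxter A A' E)
  simp only [comp_whiskerRight] at h
  simp only [br, st22]
  convert h using 1 <;> monoidal

lemma bi_yang_baxter : bi A' E (A ⊗ T) ≫ A' ◁ bi A E T ≫ bi A A' (E ⊗ T) =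
    E ◁ bi A A' T ≫ bi A E (A' ⊗ T) ≫ A ◁ bi A' E T := by
  have h := congrArg (fun k => (bi A' E (A ⊗ T) ≫ A' ◁ bi A E T ≫ bi A A' (E ⊗ T)) ≫ k ≫
    (E ◁ bi A A' T ≫ bi A E (A' ⊗ T) ≫ A ◁ bi A' E T)) (br_yang_baxter A A' E T)
  simpa using h.symm

end

section

variable (A : C) [HopfObj A] (T : C)

lemma st_mul_comul : st21 μ[A] T ≫ st12 Δ[A] T =
    st12 Δ[A] (A ⊗ T) ≫ A ◁ A ◁ st12 Δ[A] T ≫ A ◁ br A A (A ⊗ T) ≫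
      st21 μ[A] (A ⊗ A ⊗ T) ≫ A ◁ st21 μ[A] T := by
  have h := congrArg (fun k => (α_ A A T).inv ≫ k ▷ T ≫ (α_ A A T).hom) (BimonObj.mul_comul A)
  simp only [comp_whiskerRight, tensorμ, MonoidalCategory.tensorHom_def] at h
  simp only [br, st22, st21, st12]
  convert h using 1 <;> monoidal

lemma st_mul_counit : st21 μ[A] T ≫ st10 ε[A] T = A ◁ st10 ε[A] T ≫ st10 ε[A] T := by
  have h := congrArg (fun k => (α_ A A T).inv ≫ k ▷ T ≫ (λ_ T).hom) (Bimon.mul_counit A)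
  simp only [comp_whiskerRight, MonoidalCategory.tensorHom_def'] at h
  simp only [st21, st10]
  convert h using 1 <;> monoidal

lemma st_antipode_left : st12 Δ[A] T ≫ st11 𝒮[A] (A ⊗ T) ≫ st21 μ[A] T =
    st10 ε[A] T ≫ st01 η[A] T := by
  have h := congrArg (fun k => k ▷ T) (HopfObj.antipode_left A)
  simp only [comp_whiskerRight] at h
  simp only [st21, st12, st11, st10, st01]
  convert h using 1 <;> monoidal

lemma st_antipode_right : st12 Δ[A] T ≫ A ◁ st11 𝒮[A] T ≫ st21 μ[A] T =
    st10 ε[A] T ≫ st01 η[A] T := by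
  have h := congrArg (fun k => k ▷ T) (HopfObj.antipode_right A)
  simp only [comp_whiskerRight] at h
  simp only [st21, st12, st11, st10, st01]
  convert h using 1 <;> monoidal

lemma st_antipode_comul : st11 𝒮[A] T ≫ st12 Δ[A] T =
    st12 Δ[A] T ≫ br A A T ≫ st11 𝒮[A] (A ⊗ T) ≫ A ◁ st11 𝒮[A] T := by
  have h := congrArg (fun k => k ▷ T ≫ (α_ A A T).hom) (HopfObj.antipode_comul A)
  simp only [comp_whiskerRight, MonoidalCategory.tensorHom_def] at h
  simp only [br, st22, st12, st11]
  convert h using 1 <;> monoidal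

lemma st_mul_antipode : st21 μ[A] T ≫ st11 𝒮[A] T =
    st11 𝒮[A] (A ⊗ T) ≫ A ◁ st11 𝒮[A] T ≫ br A A T ≫ st21 μ[A] T := by
  have h := congrArg (fun k => (α_ A A T).inv ≫ k ▷ T) (HopfObj.mul_antipode A)
  simp only [comp_whiskerRight, MonoidalCategory.tensorHom_def] at h
  simp only [br, st22, st21, st11]
  convert h using 1 <;> monoidal

lemma st_one_antipode : st01 η[A] T ≫ st11 𝒮[A] T = st01 η[A] T := by
  simp [st01, st11, ← comp_whiskerRight]

lemma st_antipode_counit : st11 𝒮[A] T ≫ st10 ε[A] T = st10 ε[A] T := by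
  simp [st10, st11, ← comp_whiskerRight_assoc]

/-! The inverse antipode. -/

variable [IsIso 𝒮[A]]

@[simp]
lemma st_antipode_inv : st11 𝒮[A] T ≫ st11 (inv 𝒮[A]) T = 𝟙 _ := by
  simp [st11, ← comp_whiskerRight]

@[simp]
lemma st_antipode_inv_assoc {Z : C} (z : _ ⟶ Z) :
    st11 𝒮[A] T ≫ st11 (inv 𝒮[A]) T ≫ z = z := by
  rw [reassoc_of% st_antipode_inv]

@[simp]
lemma st_inv_antipode : st11 (inv 𝒮[A]) T ≫ st11 𝒮[A] T = 𝟙 _ := by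
  simp [st11, ← comp_whiskerRight]

@[simp]
lemma st_inv_antipode_assoc {Z : C} (z : _ ⟶ Z) :
    st11 (inv 𝒮[A]) T ≫ st11 𝒮[A] T ≫ z = z := by
  rw [reassoc_of% st_inv_antipode]

@[simp]
lemma whisker_antipode_inv (B : C) : B ◁ st11 𝒮[A] T ≫ B ◁ st11 (inv 𝒮[A]) T = 𝟙 _ := by
  simp [← whiskerLeft_comp]

@[simp]
lemma whisker_antipode_inv_assoc (B : C) {Z : C} (z : _ ⟶ Z) :
    B ◁ st11 𝒮[A] T ≫ B ◁ st11 (inv 𝒮[A]) T ≫ z = z := by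
  rw [reassoc_of% whisker_antipode_inv]

@[simp]
lemma whisker_inv_antipode (B : C) : B ◁ st11 (inv 𝒮[A]) T ≫ B ◁ st11 𝒮[A] T = 𝟙 _ := by
  simp [← whiskerLeft_comp]

@[simp]
lemma whisker_inv_antipode_assoc (B : C) {Z : C} (z : _ ⟶ Z) :
    B ◁ st11 (inv 𝒮[A]) T ≫ B ◁ st11 𝒮[A] T ≫ z = z := by
  rw [reassoc_of% whisker_inv_antipode]

lemma st11_inv_sq : st11 (inv (𝒮[A] ≫ 𝒮[A])) T = st11 (inv 𝒮[A]) T ≫ st11 (inv 𝒮[A]) T := by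
  simp [st11, ← comp_whiskerRight]

/-- Inverting the anticomultiplicativity of the antipode replaces its crossing by the inverse one.
-/
lemma st_inv_antipode_comul : st11 (inv 𝒮[A]) T ≫ st12 Δ[A] T =
    st12 Δ[A] T ≫ bi A A T ≫ st11 (inv 𝒮[A]) (A ⊗ T) ≫ A ◁ st11 (inv 𝒮[A]) T := by
  have h := congrArg (fun k => st11 (inv 𝒮[A]) T ≫ k ≫ A ◁ st11 (inv 𝒮[A]) T ≫
    st11 (inv 𝒮[A]) (A ⊗ T) ≫ bi A A T) (st_antipode_comul A T)
  simp only [Category.assoc, st_inv_antipode_assoc, whisker_antipode_inv_assoc,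
    st_antipode_inv_assoc, br_bi, Category.comp_id] at h
  rw [← h, ← reassoc_of% st11_nat, bi_left11, reassoc_of% bi_right11, ← st11_nat]

lemma st_mul_inv_antipode : st21 μ[A] T ≫ st11 (inv 𝒮[A]) T =
    bi A A T ≫ st11 (inv 𝒮[A]) (A ⊗ T) ≫ A ◁ st11 (inv 𝒮[A]) T ≫ st21 μ[A] T := by
  have h := congrArg (fun k => bi A A T ≫ A ◁ st11 (inv 𝒮[A]) T ≫ st11 (inv 𝒮[A]) (A ⊗ T) ≫ k ≫
    st11 (inv 𝒮[A]) T) (st_mul_antipode A T)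
  simp only [Category.assoc, st_inv_antipode_assoc, whisker_inv_antipode_assoc, bi_br_assoc,
    st_antipode_inv, Category.comp_id] at h
  rw [← h, reassoc_of% st11_nat]

lemma st_one_inv_antipode : st01 η[A] T ≫ st11 (inv 𝒮[A]) T = st01 η[A] T := by
  rw [← st_one_antipode, Category.assoc, st_antipode_inv, Category.comp_id, st_one_antipode]

lemma st_inv_antipode_counit : st11 (inv 𝒮[A]) T ≫ st10 ε[A] T = st10 ε[A] T := by
  rw [← st_antipode_counit, st_inv_antipode_assoc, st_antipode_counit]

/-- `x₍₂₎ S⁻¹(x₍₁₎) = ε(x)` -/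
lemma st_inv_antipode_right : st12 Δ[A] T ≫ bi A A T ≫ A ◁ st11 (inv 𝒮[A]) T ≫ st21 μ[A] T =
    st10 ε[A] T ≫ st01 η[A] T := by
  have h := congrArg (fun k => st11 (inv 𝒮[A]) T ≫ k) (st_antipode_left A T)
  simp only [reassoc_of% st_inv_antipode_comul, ← reassoc_of% st11_nat, st_inv_antipode_assoc] at h
  rw [reassoc_of% st_inv_antipode_counit] at h
  exact h

/-- `S⁻¹(x₍₂₎) x₍₁₎ = ε(x)` -/
lemma st_inv_antipode_left :
    st12 Δ[A] T ≫ bi A A T ≫ st11 (inv 𝒮[A]) (A ⊗ T) ≫ st21 μ[A] T =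
      st10 ε[A] T ≫ st01 η[A] T := by
  have h := congrArg (fun k => st11 (inv 𝒮[A]) T ≫ k) (st_antipode_right A T)
  simp only [reassoc_of% st_inv_antipode_comul, whisker_inv_antipode_assoc,
    reassoc_of% st_inv_antipode_counit] at h
  exact h

end

end Laws

/-! ### Dual braided Hopf algebras and the Hopf module `X` over `D` -/

section Dual

variable {C : Type w} [Category.{v} C] [MonoidalCategory C] [BraidedCategory C]
  (X D : C) [HopfObj X] [HopfObj D] [ExactPairing X D] (T : C)

/-- The right coaction of `D` on `X` dual to left multiplication: `x ↦ φ x' ⊗ ε'`, where `ε` is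
moved across `x` by the braiding. -/
def coaction (X D : C) [MonObj X] [ExactPairing X D] : X ⟶ X ⊗ D :=
  (λ_ X).inv ≫ η_ X D ▷ X ≫ (α_ X D X).hom ≫ X ◁ (β_ D X).hom ≫ (α_ X X D).inv ≫ μ[X] ▷ D

local notation "mX" => st21 (MonObj.mul (X := X))
local notation "uX" => st01 (MonObj.one (X := X))
local notation "cX" => st12 (ComonObj.comul (X := X))
local notation "eX" => st10 (ComonObj.counit (X := X))
local notation "mD" => st21 (MonObj.mul (X := D))
local notation "uD" => st01 (MonObj.one (X := D))
local notation "cD" => st12 (ComonObj.comul (X := D))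
local notation "eD" => st10 (ComonObj.counit (X := D))
local notation "sD" => st11 (HopfObj.antipode (X := D))
local notation "siD" => st11 (inv (HopfObj.antipode (X := D)))
local notation "ev" => st20 (ExactPairing.evaluation X D)
local notation "co" => st02 (ExactPairing.coevaluation X D)
local notation "act" => st21 (action X D)
local notation "rho" => st12 (coaction X D)

omit [HopfObj D] in
lemma st_coaction : rho T = co (X ⊗ T) ≫ X ◁ br D X T ≫ mX (D ⊗ T) := by
  simp only [st12, coaction, st02, br, st22, st21]
  monoidal

variable {X D}

lemma IsHopfDual.st_mul_pair (h : IsHopfDual X D) :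
    mD (X ⊗ T) ≫ ev T = D ◁ D ◁ cX T ≫ D ◁ ev (X ⊗ T) ≫ ev T := by
  have h := congrArg (fun k => (α_ D D (X ⊗ T)).inv ≫ (α_ (D ⊗ D) X T).inv ≫ k ▷ T ≫ (λ_ T).hom)
    h.mul_pair
  simp only [comp_whiskerRight, nestedEval] at h
  simp only [st21, st20, st12]
  convert h using 1 <;> monoidal

lemma IsHopfDual.st_pair_mul (h : IsHopfDual X D) :
    D ◁ mX T ≫ ev T = cD (X ⊗ X ⊗ T) ≫ D ◁ ev (X ⊗ T) ≫ ev T := by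
  have h := congrArg (fun k => D ◁ (α_ X X T).inv ≫ (α_ D (X ⊗ X) T).inv ≫ k ▷ T ≫ (λ_ T).hom)
    h.pair_mul
  simp only [comp_whiskerRight, nestedEval] at h
  simp only [st21, st20, st12]
  convert h using 1 <;> monoidal

lemma IsHopfDual.st_one_pair (h : IsHopfDual X D) : uD (X ⊗ T) ≫ ev T = eX T := by
  have h := congrArg (fun k => (λ_ (X ⊗ T)).inv ≫ (α_ (𝟙_ C) X T).inv ≫ k ▷ T ≫ (λ_ T).hom)
    h.one_pair
  simp only [comp_whiskerRight] at h
  simp only [st01, st20, st10]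
  convert h using 1 <;> monoidal

lemma IsHopfDual.st_pair_one (h : IsHopfDual X D) : D ◁ uX T ≫ ev T = eD T := by
  have h := congrArg (fun k => D ◁ (λ_ T).inv ≫ (α_ D (𝟙_ C) T).inv ≫ k ▷ T ≫ (λ_ T).hom)
    h.pair_one
  simp only [comp_whiskerRight] at h
  simp only [st01, st20, st10]
  convert h using 1 <;> monoidal

/-! ### The module structure, the comodule structure and their compatibility -/

/-- Both sides are ⟨σ, x₍₂₎⟩⟨τ, x₍₁₎⟩ x₍₃₎ by coassociativity; the nested pairing makes this a left
action without any crossing. -/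
lemma action_mul (h : IsHopfDual X D) : mD (X ⊗ T) ≫ act T = D ◁ act T ≫ act T := by
  simp only [st21_action, whiskerLeft_comp, Category.assoc]
  rw [reassoc_of% st21_nat, h.st_mul_pair, ← whiskerLeft_comp_assoc D (ev (X ⊗ T)), st20_nat,
    whiskerLeft_comp_assoc, ← whiskerLeft_comp_assoc D (D ◁ cX T), ← whiskerLeft_comp D (cX T),
    ← st_comul_assoc]
  simp only [whiskerLeft_comp, Category.assoc]

lemma action_one (h : IsHopfDual X D) : uD (X ⊗ T) ≫ act T = 𝟙 _ := by
  rw [st21_action, reassoc_of% st01_nat, h.st_one_pair, st_counit_comul]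

/-- The action is the transpose of right multiplication on `D`: after pairing with τ both sides
become τσ. -/
lemma coev_action (h : IsHopfDual X D) : D ◁ co T ≫ act (D ⊗ T) = co (D ⊗ T) ≫ X ◁ mD T := by
  apply eq_of_ev (X := X) (D := D)
  rw [whiskerLeft_comp_assoc D (co (D ⊗ T)), ← st20_nat, reassoc_of% st_ev_coev,
    whiskerLeft_comp_assoc, st21_action,
    whiskerLeft_comp_assoc, ← h.st_mul_pair, ← reassoc_of% st21_nat, st_ev_coev, Category.comp_id]

/-- Transposes the product of `X` into the coproduct of `D`; this is what makes `coaction`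
coassociative. -/
lemma coev_comul (h : IsHopfDual X D) : co T ≫ X ◁ cD T = co T ≫ X ◁ co (D ⊗ T) ≫
  mX (D ⊗ D ⊗ T) := by
  apply eq_of_ev (X := X) (D := D)
  rw [whiskerLeft_comp_assoc, ← st20_nat, reassoc_of% st_ev_coev, whiskerLeft_comp_assoc,
    whiskerLeft_comp_assoc, h.st_pair_mul, ← reassoc_of% st12_nat, ← reassoc_of% st12_nat,
    ← whiskerLeft_comp_assoc D (D ◁ X ◁ co (D ⊗ T)), ← st20_nat, whiskerLeft_comp_assoc,
    ← whiskerLeft_comp_assoc D (D ◁ co T), st_ev_coev, whiskerLeft_id, Category.id_comp,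
    st_ev_coev, Category.comp_id]

lemma coev_counit (h : IsHopfDual X D) : co T ≫ X ◁ eD T = uX T := by
  rw [← h.st_pair_one, whiskerLeft_comp, reassoc_of% st02_nat, st_coev_ev, Category.comp_id]

/-- `σ ▷ (y x) = (σ₍₂₎ ▷ y)' (σ₍₁₎' ▷ x)`, with the inverse of the braiding. -/
lemma action_mul_right (h : IsHopfDual X D) : D ◁ mX T ≫ act T =
    cD (X ⊗ X ⊗ T) ≫ D ◁ act (X ⊗ T) ≫ bi X D (X ⊗ T) ≫ X ◁ act T ≫ mX T := by
  have key : D ◁ br X X (X ⊗ T) ≫ ev (X ⊗ X ⊗ T) = bi X D (X ⊗ X ⊗ T) ≫ X ◁ ev (X ⊗ T) := by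
    rw [br_right20, bi_br_assoc]
  have key' : D ◁ D ◁ X ◁ X ◁ cX T ≫ D ◁ ev (X ⊗ X ⊗ X ⊗ T) =
      D ◁ ev (X ⊗ X ⊗ T) ≫ D ◁ X ◁ cX T := by
    simp only [← whiskerLeft_comp, st20_nat]
  rw [st21_action, ← whiskerLeft_comp_assoc D (mX T), st_mul_comul]
  simp only [whiskerLeft_comp, Category.assoc]
  rw [← st20_nat, reassoc_of% h.st_pair_mul]
  simp only [← reassoc_of% st12_nat]
  simp only [← whiskerLeft_comp_assoc, ← st20_nat]
  simp only [whiskerLeft_comp, Category.assoc]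
  rw [reassoc_of% key, reassoc_of% key', ← reassoc_of% bi_nat]
  simp only [st21_action, whiskerLeft_comp, Category.assoc]

/-- x (σ ▷ y) = σ₍₁₎ ▷ ((S(σ₍₂₎) ▷ x) y), with σ braided past x. Expanding the outer action by
`action_mul_right` brings σ₍₂₎S(σ₍₃₎) next to x, which collapses to the counit, and the two
crossings cancel. -/
lemma mul_action (h : IsHopfDual X D) : X ◁ act T ≫ mX T = br X D (X ⊗ T) ≫ cD (X ⊗ X ⊗ T) ≫
    D ◁ sD (X ⊗ X ⊗ T) ≫ D ◁ act (X ⊗ T) ≫ D ◁ mX T ≫ act T := by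
  have key : D ◁ cD (X ⊗ X ⊗ T) ≫ D ◁ D ◁ sD (X ⊗ X ⊗ T) ≫ D ◁ mD (X ⊗ X ⊗ T) =
      D ◁ eD (X ⊗ X ⊗ T) ≫ D ◁ uD (X ⊗ X ⊗ T) := by
    simp only [← whiskerLeft_comp, st_antipode_right]
  have key' : D ◁ uD (X ⊗ X ⊗ T) ≫ D ◁ act (X ⊗ T) = 𝟙 _ := by
    rw [← whiskerLeft_comp, action_one _ h, whiskerLeft_id]
  rw [action_mul_right _ h]
  rw [← reassoc_of% st12_nat, ← reassoc_of% st12_nat, ← reassoc_of% st_comul_assoc]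
  rw [← whiskerLeft_comp_assoc D (D ◁ act (X ⊗ T)), ← action_mul _ h]
  simp only [whiskerLeft_comp, Category.assoc]
  rw [reassoc_of% key, reassoc_of% key', reassoc_of% st_comul_counit, br_bi_assoc]

/-- `ρ(τ ▷ x) = τ₍₁₎ ▷ x₍₀₎ ⊗ x₍₁₎ S(τ₍₂₎)`, with `τ₍₂₎` moved across `x` by the braiding. -/
lemma action_coaction (h : IsHopfDual X D) : act T ≫ rho T =
    cD (X ⊗ T) ≫ D ◁ br D X T ≫ D ◁ rho (D ⊗ T) ≫ D ◁ X ◁ D ◁ sD T ≫ D ◁ X ◁ mD T ≫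
      act (D ⊗ T) := by
  have key : X ◁ D ◁ act T ≫ X ◁ br D X T =
      X ◁ br D D (X ⊗ T) ≫ X ◁ D ◁ br D X T ≫ X ◁ act (D ⊗ T) := by
    simp only [← whiskerLeft_comp, br_right21]
  have key₁ : D ◁ D ◁ X ◁ br D X T ≫ D ◁ act (X ⊗ D ⊗ T) =
      D ◁ act (D ⊗ X ⊗ T) ≫ D ◁ X ◁ br D X T := by
    simp only [← whiskerLeft_comp, st21_nat]
  have key₂ : D ◁ D ◁ co (X ⊗ T) ≫ D ◁ act (D ⊗ X ⊗ T) =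
      D ◁ co (D ⊗ X ⊗ T) ≫ D ◁ X ◁ mD (X ⊗ T) := by
    simp only [← whiskerLeft_comp, coev_action _ h]
  have key₃ : D ◁ X ◁ mD (X ⊗ T) ≫ D ◁ X ◁ br D X T =
      D ◁ X ◁ D ◁ br D X T ≫ D ◁ X ◁ br D X (D ⊗ T) ≫ D ◁ X ◁ X ◁ mD T := by
    simp only [← whiskerLeft_comp, br_left21]
  have key₄ : D ◁ mX (D ⊗ D ⊗ T) ≫ D ◁ X ◁ mD T = D ◁ X ◁ X ◁ mD T ≫ D ◁ mX (D ⊗ T) := by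
    simp only [← whiskerLeft_comp, st21_nat]
  have key₅ : D ◁ sD (X ⊗ T) ≫ D ◁ co (D ⊗ X ⊗ T) ≫ D ◁ X ◁ D ◁ br D X T ≫
      D ◁ X ◁ br D X (D ⊗ T) = D ◁ br D X T ≫ D ◁ co (X ⊗ D ⊗ T) ≫
        D ◁ X ◁ br D X (D ⊗ T) ≫ D ◁ X ◁ X ◁ D ◁ sD T := by
    have k : sD (X ⊗ T) ≫ co (D ⊗ X ⊗ T) ≫ X ◁ D ◁ br D X T ≫ X ◁ br D X (D ⊗ T) =
        br D X T ≫ co (X ⊗ D ⊗ T) ≫ X ◁ br D X (D ⊗ T) ≫ X ◁ X ◁ D ◁ sD T := by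
      simp only [← whiskerLeft_comp, br_nat]
      rw [← reassoc_of% st02_nat, ← reassoc_of% st02_nat]
      have k' : X ◁ D ◁ sD (X ⊗ T) ≫ X ◁ D ◁ br D X T =
          X ◁ D ◁ br D X T ≫ X ◁ D ◁ X ◁ sD T := by
        simp only [← whiskerLeft_comp, br_left11]
      simp only [whiskerLeft_comp, reassoc_of% k']
    simpa only [whiskerLeft_comp] using congrArg (fun t => D ◁ t) k
  have key₇ : D ◁ D ◁ co (X ⊗ T) ≫ D ◁ D ◁ X ◁ br D X T ≫ D ◁ sD (X ⊗ X ⊗ D ⊗ T) =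
      D ◁ sD (X ⊗ T) ≫ D ◁ D ◁ co (X ⊗ T) ≫ D ◁ D ◁ X ◁ br D X T := by
    have k : D ◁ co (X ⊗ T) ≫ D ◁ X ◁ br D X T ≫ sD (X ⊗ X ⊗ D ⊗ T) =
        sD (X ⊗ T) ≫ D ◁ co (X ⊗ T) ≫ D ◁ X ◁ br D X T := by
      simp only [← st11_nat, reassoc_of% st11_nat]
    simpa only [whiskerLeft_comp] using congrArg (fun t => D ◁ t) k
  have key₆ : D ◁ X ◁ X ◁ D ◁ sD T ≫ D ◁ mX (D ⊗ D ⊗ T) =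
      D ◁ mX (D ⊗ D ⊗ T) ≫ D ◁ X ◁ D ◁ sD T := by
    simp only [← whiskerLeft_comp, st21_nat]
  -- `mul_action` pulls τ out of φ(τ ▷ x) as τ₍₁₎ ▷ ((S(τ₍₂₎) ▷ φ) x), and τ then slides off the
  -- whole canonical element by `br_left02`. `coev_action` (`key₂`) turns S(τ₍₂₎) ▷ φ ⊗ ε into φ ⊗ ε
  -- S(τ₍₂₎).
  rw [st_coaction, ← reassoc_of% st02_nat, reassoc_of% key, mul_action _ h,
    ← reassoc_of% br_nat, reassoc_of% br_left02]
  simp only [← reassoc_of% st12_nat]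
  rw [reassoc_of% key₇, reassoc_of% key₁, reassoc_of% key₂, reassoc_of% key₃]
  simp only [st_coaction, whiskerLeft_comp, Category.assoc]
  rw [← reassoc_of% key₆, reassoc_of% key₄, ← reassoc_of% key₅]

local notation "int" => st11 (braidedIntegral X D)

/-- `ρ` is coassociative for the coproduct `Δ ≫ β⁻¹` of `D`. -/
lemma coaction_comul (h : IsHopfDual X D) :
    rho T ≫ X ◁ cD T = rho T ≫ rho (D ⊗ T) ≫ X ◁ br D D T := by
  have k₁ : X ◁ br D X T ≫ X ◁ X ◁ cD T =
      X ◁ cD (X ⊗ T) ≫ X ◁ D ◁ br D X T ≫ X ◁ br D X (D ⊗ T) := by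
    simp only [← whiskerLeft_comp, br_left12]
  have k₂ : X ◁ D ◁ mX (D ⊗ T) ≫ X ◁ br D X (D ⊗ T) =
      X ◁ br D X (X ⊗ D ⊗ T) ≫ X ◁ X ◁ br D X (D ⊗ T) ≫ X ◁ mX (D ⊗ D ⊗ T) := by
    simp only [← whiskerLeft_comp, br_right21]
  have k₃ : X ◁ mX (D ⊗ D ⊗ T) ≫ X ◁ X ◁ br D D T =
      X ◁ X ◁ X ◁ br D D T ≫ X ◁ mX (D ⊗ D ⊗ T) := by
    simp only [← whiskerLeft_comp, st21_nat]
  have k₄ : X ◁ D ◁ X ◁ br D X T ≫ X ◁ br D X (X ⊗ D ⊗ T) =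
      X ◁ br D X (D ⊗ X ⊗ T) ≫ X ◁ X ◁ D ◁ br D X T := by
    simp only [← whiskerLeft_comp, br_nat]
  have k₅ : X ◁ X ◁ D ◁ br D X T ≫ X ◁ X ◁ br D X (D ⊗ T) ≫ X ◁ X ◁ X ◁ br D D T =
      X ◁ X ◁ br D D (X ⊗ T) ≫ X ◁ X ◁ D ◁ br D X T ≫ X ◁ X ◁ br D X (D ⊗ T) := by
    simp only [← whiskerLeft_comp, br_yang_baxter]
  have k₆ : X ◁ D ◁ co (X ⊗ T) ≫ X ◁ br D X (D ⊗ X ⊗ T) ≫ X ◁ X ◁ br D D (X ⊗ T) =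
      X ◁ co (D ⊗ X ⊗ T) := by
    simp only [← whiskerLeft_comp, br_right02]
  simp only [st_coaction, Category.assoc]
  rw [st21_nat, reassoc_of% k₁, reassoc_of% coev_comul _ h, st21_nat, ← reassoc_of% st02_nat,
    reassoc_of% k₂, reassoc_of% k₃, st_mul_assoc, ← reassoc_of% st02_nat, reassoc_of% k₄,
    reassoc_of% k₅, ← reassoc_of% st02_nat, reassoc_of% k₆, reassoc_of% st21_nat,
    reassoc_of% st21_nat]

lemma coaction_counit (h : IsHopfDual X D) : rho T ≫ X ◁ eD T = 𝟙 _ := by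
  have k : X ◁ br D X T ≫ X ◁ X ◁ eD T = X ◁ eD (X ⊗ T) := by
    simp only [← whiskerLeft_comp, br_left10]
  rw [st_coaction, Category.assoc, Category.assoc, st21_nat, reassoc_of% k,
    reassoc_of% coev_counit _ h, st_one_mul]

/-! ### The braided integral: coinvariance, reconstruction and invariance -/

variable [IsIso 𝒮[D]]

/-- Puts the trace formula in Hopf module form. Sliding the inverse crossing through the product of
`X` cancels the crossing in `coaction` and leaves one on the canonical element, which is
`twistedCoev`. -/
lemma st_braidedIntegral :
    int T = rho T ≫ bi D X T ≫ siD (X ⊗ T) ≫ siD (X ⊗ T) ≫ act T := by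
  have k : X ◁ bi D X T ≫ bi D X (X ⊗ T) ≫ D ◁ mX T = mX (D ⊗ T) ≫ bi D X T := by
    rw [bi_right21]
  have k' : X ◁ br D X T ≫ X ◁ bi D X T = 𝟙 _ := whisker_br_bi _ _ _ _
  have k₂ : co (X ⊗ T) ≫ bi D X (X ⊗ T) = st02 (twistedCoev X D) (X ⊗ T) := by
    simp [st02, bi, st22, twistedCoev]
  rw [st_coaction, Category.assoc, Category.assoc, ← reassoc_of% k, reassoc_of% k',
    reassoc_of% k₂, ← Category.assoc (siD (X ⊗ T)), ← st11_inv_sq, ← reassoc_of% st11_nat]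
  simp only [st11, st02, braidedIntegral, st21]
  monoidal

omit [ExactPairing X D] [HopfObj X] in
lemma st_inv_sq_comul : siD T ≫ siD T ≫ cD T = cD T ≫ bi D D T ≫ bi D D T ≫
    D ◁ siD T ≫ D ◁ siD T ≫ siD (D ⊗ T) ≫ siD (D ⊗ T) := by
  rw [st_inv_antipode_comul, reassoc_of% st_inv_antipode_comul, reassoc_of% bi_left11,
    reassoc_of% bi_right11, st11_nat, reassoc_of% st11_nat]

omit [IsIso 𝒮[D]] in
lemma coaction_coaction (h : IsHopfDual X D) :
    rho T ≫ rho (D ⊗ T) = rho T ≫ X ◁ cD T ≫ X ◁ bi D D T := by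
  rw [reassoc_of% coaction_comul _ h, whisker_br_bi, Category.comp_id]

/-- The values of the braided integral are coinvariant. -/
lemma braidedIntegral_coaction (h : IsHopfDual X D) : int T ≫ rho T = int T ≫ X ◁ uD T := by
  have k₁ : siD (D ⊗ X ⊗ T) ≫ siD (D ⊗ X ⊗ T) ≫ D ◁ br D X T ≫ D ◁ rho (D ⊗ T) ≫
      D ◁ X ◁ D ◁ sD T ≫ D ◁ X ◁ mD T = D ◁ br D X T ≫ D ◁ rho (D ⊗ T) ≫
      D ◁ X ◁ D ◁ sD T ≫ D ◁ X ◁ mD T ≫ siD (X ⊗ D ⊗ T) ≫ siD (X ⊗ D ⊗ T) := by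
    simp only [st11_nat, reassoc_of% st11_nat]
  have k₂ : D ◁ bi D X T ≫ D ◁ siD (X ⊗ T) ≫ D ◁ siD (X ⊗ T) ≫ D ◁ br D X T =
      D ◁ X ◁ siD T ≫ D ◁ X ◁ siD T := by
    simp only [← whiskerLeft_comp, ← reassoc_of% bi_left11, bi_br, Category.comp_id]
  have k₃ : D ◁ X ◁ siD T ≫ D ◁ X ◁ siD T ≫ D ◁ rho (D ⊗ T) ≫ D ◁ X ◁ D ◁ sD T =
      D ◁ rho (D ⊗ T) ≫ D ◁ X ◁ D ◁ siD T := by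
    simp only [← whiskerLeft_comp, ← reassoc_of% st12_nat, st_inv_antipode,
      Category.comp_id]
  have k₄ : X ◁ D ◁ bi D D T ≫ X ◁ bi D D (D ⊗ T) ≫ X ◁ D ◁ D ◁ siD T ≫ X ◁ D ◁ mD T =
      X ◁ D ◁ siD (D ⊗ T) ≫ X ◁ mD (D ⊗ T) ≫ X ◁ bi D D T := by
    simp only [← whiskerLeft_comp]
    congr 1
    rw [whiskerLeft_comp, reassoc_of% bi_nat, bi_right21,
      ← whiskerLeft_comp_assoc D (bi D D T), ← bi_right11, whiskerLeft_comp_assoc]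
  have k₅ : X ◁ cD (D ⊗ T) ≫ X ◁ bi D D (D ⊗ T) ≫ X ◁ D ◁ siD (D ⊗ T) ≫ X ◁ mD (D ⊗ T) =
      X ◁ eD (D ⊗ T) ≫ X ◁ uD (D ⊗ T) := by
    simp only [← whiskerLeft_comp, st_inv_antipode_right]
  have k₆ : X ◁ uD (D ⊗ T) ≫ X ◁ bi D D T = X ◁ D ◁ uD T := by
    simp only [← whiskerLeft_comp, bi_right01]
  -- The power S⁻² matters here: `action_coaction` contributes one S, so S⁻¹ is left (`k₃`), and
  -- x₍₂₎S⁻¹(x₍₁₎) = ε(x) in `D` reduces the coaction leg to the unit.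
  have e : rho T ≫ rho (D ⊗ T) ≫ rho (D ⊗ D ⊗ T) ≫ X ◁ D ◁ siD (D ⊗ T) ≫ X ◁ mD (D ⊗ T) =
      rho T ≫ X ◁ uD (D ⊗ T) := by
    rw [reassoc_of% coaction_coaction (D ⊗ T) h, k₅, reassoc_of% coaction_counit _ h]
  simp only [st_braidedIntegral, Category.assoc]
  rw [action_coaction _ h, reassoc_of% st_inv_sq_comul, reassoc_of% k₁,
    ← reassoc_of% bi_left12, reassoc_of% bi_yang_baxter, reassoc_of% bi_yang_baxter,
    reassoc_of% k₂, reassoc_of% k₃, reassoc_of% coaction_comul _ h, whisker_br_bi_assoc,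
    ← reassoc_of% bi_right12, ← reassoc_of% st12_nat, reassoc_of% bi_nat, reassoc_of% bi_nat,
    reassoc_of% k₄, reassoc_of% e, reassoc_of% k₆, ← reassoc_of% bi_nat]
  simp only [← reassoc_of% st11_nat, ← st21_nat]

/-- Every `x` is `∑ S⁻¹(x₍₁₎) ▷ I(x₍₀₎)`. -/
lemma eq_coaction_integral_action (h : IsHopfDual X D) :
    rho T ≫ bi D X T ≫ siD (X ⊗ T) ≫ D ◁ int T ≫ act T = 𝟙 _ := by
  have k₁ : D ◁ bi D X T ≫ D ◁ siD (X ⊗ T) ≫ D ◁ siD (X ⊗ T) =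
      D ◁ X ◁ siD T ≫ D ◁ X ◁ siD T ≫ D ◁ bi D X T := by
    simp only [← whiskerLeft_comp, ← bi_left11, ← reassoc_of% bi_left11]
  -- The factors S⁻¹ and S⁻² share an outer S⁻¹, pulled out by antimultiplicativity; inside remains
  -- S⁻¹(d₍₂₎)d₍₁₎, which `k₃` collapses.
  have k₂ : X ◁ (bi D D T ≫ siD (D ⊗ T) ≫ D ◁ siD T ≫ D ◁ siD T ≫ mD T) =
      X ◁ (siD (D ⊗ T) ≫ mD T ≫ siD T) := by
    rw [st_mul_inv_antipode, reassoc_of% bi_right11, reassoc_of% st11_nat]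
  have k₃ : X ◁ cD T ≫ X ◁ bi D D T ≫ X ◁ siD (D ⊗ T) ≫ X ◁ mD T =
      X ◁ eD T ≫ X ◁ uD T := by
    simp only [← whiskerLeft_comp, st_inv_antipode_left]
  have k₄ : X ◁ uD T ≫ X ◁ siD T = X ◁ uD T := by
    simp only [← whiskerLeft_comp, st_one_inv_antipode]
  simp only [whiskerLeft_comp] at k₂
  simp only [st_braidedIntegral, whiskerLeft_comp, Category.assoc]
  rw [← action_mul _ h, reassoc_of% st11_nat, ← reassoc_of% bi_right12,
    reassoc_of% k₁, ← reassoc_of% bi_left11, reassoc_of% bi_nat, reassoc_of% bi_nat,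
    ← reassoc_of% bi_left21, reassoc_of% coaction_coaction _ h, reassoc_of% k₂, reassoc_of% k₃,
    reassoc_of% coaction_counit _ h, reassoc_of% k₄, reassoc_of% bi_left01, action_one _ h]

/-- `ρ(τ ▷ I(x)) = τ₍₁₎ ▷ I(x) ⊗ S(τ₍₂₎)`, with `τ₍₂₎` moved across `x`. -/
lemma integral_action_coaction (h : IsHopfDual X D) :
    D ◁ int T ≫ act T ≫ rho T = cD (X ⊗ T) ≫ D ◁ br D X T ≫ D ◁ X ◁ sD T ≫
      D ◁ int (D ⊗ T) ≫ act (D ⊗ T) := by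
  have k₁ : D ◁ D ◁ int T ≫ D ◁ br D X T = D ◁ br D X T ≫ D ◁ int (D ⊗ T) := by
    simp only [← whiskerLeft_comp, br_right11]
  have k₂ : D ◁ int (D ⊗ T) ≫ D ◁ rho (D ⊗ T) = D ◁ int (D ⊗ T) ≫ D ◁ X ◁ uD (D ⊗ T) := by
    simp only [← whiskerLeft_comp, braidedIntegral_coaction _ h]
  have k₃ : D ◁ X ◁ uD (D ⊗ T) ≫ D ◁ X ◁ D ◁ sD T ≫ D ◁ X ◁ mD T = D ◁ X ◁ sD T := by
    simp only [← whiskerLeft_comp, reassoc_of% st01_nat, st_one_mul, Category.comp_id]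
  have k₄ : D ◁ int (D ⊗ T) ≫ D ◁ X ◁ sD T = D ◁ X ◁ sD T ≫ D ◁ int (D ⊗ T) := by
    simp only [← whiskerLeft_comp, st11_nat]
  rw [action_coaction _ h, ← reassoc_of% st12_nat, reassoc_of% k₁, reassoc_of% k₂,
    reassoc_of% k₃, reassoc_of% k₄]

/-- `∑ S⁻¹(x₍₁₎) ⊗ x₍₀₎` for `x = τ ▷ I(y)`. -/
lemma integral_action_coaction_inv (h : IsHopfDual X D) :
    D ◁ int T ≫ act T ≫ rho T ≫ bi D X T ≫ siD (X ⊗ T) =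
      cD (X ⊗ T) ≫ bi D D (X ⊗ T) ≫ D ◁ D ◁ int T ≫ D ◁ act T := by
  have k₁ : D ◁ X ◁ sD T ≫ D ◁ int (D ⊗ T) ≫ D ◁ bi D X T =
      D ◁ bi D X T ≫ D ◁ sD (X ⊗ T) ≫ D ◁ D ◁ int T := by
    simp only [← whiskerLeft_comp, bi_right11, ← reassoc_of% bi_left11]
  rw [reassoc_of% integral_action_coaction _ h, reassoc_of% bi_right21, reassoc_of% k₁]
  rw [whisker_br_bi_assoc, ← reassoc_of% bi_nat, reassoc_of% bi_left11, ← st11_nat,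
    ← reassoc_of% st11_nat, st_antipode_inv_assoc]

/-- By `integral_action_coaction_inv` the left side is S⁻¹(τ₍₂₎)τ₍₁₎ ▷ I(y), with an inverse
crossing of the two legs, and the product is ε(τ). -/
lemma integral_action_integral (h : IsHopfDual X D) :
    D ◁ int T ≫ act T ≫ int T = eD (X ⊗ T) ≫ int T := by
  have e := integral_action_coaction_inv T h
  have e' := congrArg (fun k => k ≫ siD (X ⊗ T) ≫ act T) e
  simp only [Category.assoc] at e'
  rw [show act T ≫ int T = act T ≫ rho T ≫ bi D X T ≫ siD (X ⊗ T) ≫ siD (X ⊗ T) ≫ act T by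
    rw [st_braidedIntegral], e', ← reassoc_of% st11_nat, ← reassoc_of% st11_nat,
    ← action_mul _ h, ← reassoc_of% st21_nat, reassoc_of% st_inv_antipode_left,
    reassoc_of% st01_nat, action_one _ h, Category.comp_id]

/-- The braided integral is invariant under the action of `D`. -/
lemma action_integral (h : IsHopfDual X D) : act T ≫ int T = eD (X ⊗ T) ≫ int T := by
  have e := eq_coaction_integral_action T h
  -- By `e` it suffices to treat x = τ ▷ I(y). There σ acts through στ, the counit is
  -- multiplicative, and `e₁` reassembles ε(τ)I(y) into I(x).
  have e₁ : int T = rho T ≫ bi D X T ≫ siD (X ⊗ T) ≫ eD (X ⊗ T) ≫ int T := by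
    rw [← integral_action_integral _ h, reassoc_of% e]
  have e₂ := congrArg (fun k => D ◁ k ≫ act T ≫ int T) e
  simp only [whiskerLeft_comp, whiskerLeft_id, Category.id_comp, Category.assoc] at e₂
  rw [← e₂, ← reassoc_of% action_mul _ h, ← reassoc_of% st21_nat, integral_action_integral _ h,
    reassoc_of% st_mul_counit]
  conv_rhs => rw [e₁]
  simp only [reassoc_of% st10_nat]

/-- `∑ S⁻¹(x₍₁₎) ⊗ I(x₍₀₎) = τ ⊗ I(y)` for `x = τ ▷ I(y)`. -/
lemma integral_action_coaction_integral (h : IsHopfDual X D) :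
    D ◁ int T ≫ act T ≫ rho T ≫ bi D X T ≫ siD (X ⊗ T) ≫ D ◁ int T = D ◁ int T := by
  have k : D ◁ D ◁ int T ≫ D ◁ act T ≫ D ◁ int T = D ◁ eD (X ⊗ T) ≫ D ◁ int T := by
    simp only [← whiskerLeft_comp, integral_action_integral _ h]
  rw [reassoc_of% integral_action_coaction_inv _ h, k, ← reassoc_of% bi_right10,
    reassoc_of% st_counit_comul]

/-- The values of the braided integral are left integrals of `X`. -/
lemma mul_integral (h : IsHopfDual X D) : X ◁ int T ≫ mX T = eX (X ⊗ T) ≫ int T := by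
  -- Pairing the `D` leg of ρ(y) with x, after braiding x past y, recovers xy; coinvariance of I(y)
  -- then yields ε(x)I(y).
  have k₁ : br X X T ≫ rho (X ⊗ T) ≫ X ◁ ev T = mX T := by
    have k : X ◁ D ◁ br X X T ≫ X ◁ br D X (X ⊗ T) ≫ X ◁ X ◁ ev T = X ◁ ev (X ⊗ T) := by
      simp only [← whiskerLeft_comp, br_left20]
    rw [st_coaction, Category.assoc, Category.assoc, st21_nat, ← reassoc_of% st02_nat,
      reassoc_of% k, reassoc_of% st_coev_ev]
  have k₂ : X ◁ uD (X ⊗ T) ≫ X ◁ ev T = X ◁ eX T := by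
    simp only [← whiskerLeft_comp, h.st_one_pair]
  rw [← k₁, reassoc_of% br_right11, reassoc_of% braidedIntegral_coaction _ h, k₂, st11_nat,
    ← reassoc_of% br_left10]

end Dual

/-! ### The resulting identities with the tail removed (`T` the unit object) -/

section Unstacked

variable {C : Type w} [Category.{v} C] [MonoidalCategory C] [BraidedCategory C]
  {X D : C} [HopfObj X] [HopfObj D] [ExactPairing X D] [IsIso 𝒮[D]]

lemma action_comp_braidedIntegral (h : IsHopfDual X D) :
    action X D ≫ braidedIntegral X D = ε[D] ▷ X ≫ (λ_ X).hom ≫ braidedIntegral X D := by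
  have e := congrArg (fun k => D ◁ (ρ_ X).inv ≫ k ≫ (ρ_ X).hom) (action_integral (𝟙_ C) h)
  simp only [st21, st10, st11] at e
  convert e using 1 <;> monoidal

lemma whiskerLeft_braidedIntegral_mul (h : IsHopfDual X D) :
    X ◁ braidedIntegral X D ≫ μ[X] = ε[X] ▷ X ≫ (λ_ X).hom ≫ braidedIntegral X D := by
  have e := congrArg (fun k => X ◁ (ρ_ X).inv ≫ k ≫ (ρ_ X).hom) (mul_integral (𝟙_ C) h)
  simp only [st21, st10, st11] at e
  convert e using 1 <;> monoidal

/-- The Hopf module isomorphism, stated without forming the image of `I`. Here θ is x ↦ S⁻¹(x₍₁₎) ⊗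
x₍₀₎ with the inverse braiding; followed by `D ◁ I` it inverts σ ⊗ I(y) ↦ σ ▷ I(y). -/
lemma exists_section (h : IsHopfDual X D) : ∃ θ : X ⟶ D ⊗ X,
    θ ≫ D ◁ braidedIntegral X D ≫ action X D = 𝟙 X ∧
    D ◁ braidedIntegral X D ≫ action X D ≫ θ ≫ D ◁ braidedIntegral X D =
      D ◁ braidedIntegral X D := by
  refine ⟨coaction X D ≫ (β_ D X).inv ≫ inv 𝒮[D] ▷ X, ?_, ?_⟩
  · have e := congrArg (fun k => (ρ_ X).inv ≫ k ≫ (ρ_ X).hom)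
      (eq_coaction_integral_action (𝟙_ C) h)
    simp only [st21, st12, bi, st22, st11, Category.id_comp, Iso.inv_hom_id] at e
    rw [← e]
    monoidal
  · have e := congrArg (fun k => D ◁ (ρ_ X).inv ≫ k ≫ D ◁ (ρ_ X).hom)
      (integral_action_coaction_integral (𝟙_ C) h)
    simp only [st21, st12, bi, st22, st11] at e
    convert e using 1 <;> monoidal

end Unstacked

/-! ### Transport to underlying vector spaces -/

section Linear

variable {k : Type u} [Field k] {C : Type w} [Category.{v} C] [MonoidalCategory C]
  (F : C ⥤ ModuleCat.{u} k) [F.Monoidal]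

open Functor.LaxMonoidal Functor.OplaxMonoidal Functor.Monoidal

/-- The bilinear map on underlying vector spaces induced by a morphism `A ⊗ B ⟶ Y`. -/
def bilin {A B Y : C} (f : A ⊗ B ⟶ Y) : F.obj A →ₗ[k] F.obj B →ₗ[k] F.obj Y :=
  TensorProduct.curry (Functor.LaxMonoidal.μ F A B ≫ F.map f).hom

/-- The counit on the underlying vector space. -/
def counitLin (A : C) [ComonObj A] : F.obj A →ₗ[k] k :=
  (F.map ε[A] ≫ Functor.OplaxMonoidal.η F).hom

/-- The canonical element of the tensor product of the underlying vector spaces. -/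
def coevElt (X D : C) [ExactPairing X D] : F.obj X ⊗[k] F.obj D :=
  (Functor.LaxMonoidal.ε F ≫ F.map (η_ X D) ≫ Functor.OplaxMonoidal.δ F X D).hom (1 : k)

lemma bilin_comp {A B Y Z : C} (f : A ⊗ B ⟶ Y) (g : Y ⟶ Z) (a : F.obj A) (b : F.obj B) :
    bilin F (f ≫ g) a b = (F.map g).hom (bilin F f a b) := by
  simp [bilin]

lemma bilin_whiskerLeft {A B B' Y : C} (g : B ⟶ B') (f : A ⊗ B' ⟶ Y) (a : F.obj A)
    (b : F.obj B) : bilin F (A ◁ g ≫ f) a b = bilin F f a ((F.map g).hom b) := by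
  have h : Functor.LaxMonoidal.μ F A B ≫ F.map (A ◁ g ≫ f) =
      F.obj A ◁ F.map g ≫ Functor.LaxMonoidal.μ F A B' ≫ F.map f := by simp
  exact congrArg (fun t => t.hom (a ⊗ₜ[k] b)) h

lemma bilin_counit {A B Y : C} [ComonObj A] (f : B ⟶ Y) (a : F.obj A) (b : F.obj B) :
    bilin F (ε[A] ▷ B ≫ (λ_ B).hom ≫ f) a b = counitLin F A a • (F.map f).hom b := by
  have h : Functor.LaxMonoidal.μ F A B ≫ F.map (ε[A] ▷ B ≫ (λ_ B).hom ≫ f) =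
      (F.map ε[A] ≫ Functor.OplaxMonoidal.η F) ▷ F.obj B ≫ (λ_ (F.obj B)).hom ≫ F.map f := by
    simp
  have e := congrArg (fun t => t.hom (a ⊗ₜ[k] b)) h
  refine e.trans ?_
  exact (F.map f).hom.map_smul (counitLin F A a) b

section

variable (X D : C) [ExactPairing X D]

lemma bilin_action [ComonObj X] (s : F.obj D) (x : F.obj X) :
    bilin F (action X D) s x =
      TensorProduct.lid k (F.obj X) ((pairing F X D s).rTensor (F.obj X) (comulLin F X x)) := by
  have h : Functor.LaxMonoidal.μ F D X ≫ F.map (action X D) =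
      F.obj D ◁ (F.map Δ[X] ≫ Functor.OplaxMonoidal.δ F X X) ≫ (α_ _ _ _).inv ≫
        (Functor.LaxMonoidal.μ F D X ≫ F.map (ε_ X D) ≫ Functor.OplaxMonoidal.η F) ▷ F.obj X ≫
          (λ_ (F.obj X)).hom := by
    simp only [action, Functor.map_comp, map_whiskerLeft, map_whiskerRight, map_associator_inv,
      map_leftUnitor, Category.assoc, μ_δ_assoc, comp_whiskerRight, whiskerLeft_comp]
  have e := congrArg (fun t => t.hom (s ⊗ₜ[k] x)) h
  refine e.trans ?_
  have key (t : F.obj X ⊗[k] F.obj X) : TensorProduct.lid k (F.obj X)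
      (LinearMap.rTensor (F.obj X) (Functor.LaxMonoidal.μ F D X ≫ F.map (ε_ X D) ≫
        Functor.OplaxMonoidal.η F).hom ((TensorProduct.assoc k _ _ _).symm (s ⊗ₜ[k] t))) =
      TensorProduct.lid k (F.obj X) ((pairing F X D s).rTensor (F.obj X) t) := by
    induction t with
    | zero => simp
    | tmul a b => rfl
    | add a b ha hb => simp only [TensorProduct.tmul_add, map_add, ha, hb]
  exact key _

/-- A strong monoidal functor preserves exact pairings: this is the image of a zigzag identity. -/
lemma coevElt_left (x : F.obj X) : TensorProduct.rid k (F.obj X)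
    (((pairing F X D).flip x).lTensor (F.obj X) (coevElt F X D)) = x := by
  have h : (λ_ (F.obj X)).inv ≫ (Functor.LaxMonoidal.ε F ≫ F.map (η_ X D) ≫
      Functor.OplaxMonoidal.δ F X D) ▷ F.obj X ≫ (α_ _ _ _).hom ≫ F.obj X ◁
      (Functor.LaxMonoidal.μ F D X ≫ F.map (ε_ X D) ≫ Functor.OplaxMonoidal.η F) ≫
        (ρ_ (F.obj X)).hom = 𝟙 _ := by
    have e := congrArg (fun t => F.map ((λ_ X).inv ≫ t ≫ (ρ_ X).hom))
      (ExactPairing.evaluation_coevaluation X D)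
    simp only [Functor.map_comp, map_whiskerLeft, map_whiskerRight, map_associator,
      map_leftUnitor_inv, map_rightUnitor, Category.assoc, μ_δ_assoc, Category.comp_id,
      Iso.inv_hom_id, CategoryTheory.Functor.map_id] at e
    simpa only [comp_whiskerRight, whiskerLeft_comp, Category.assoc] using e
  have e := congrArg (fun t => t.hom x) h
  refine Eq.trans ?_ e
  have key (t : F.obj X ⊗[k] F.obj D) : TensorProduct.rid k (F.obj X)
      (((pairing F X D).flip x).lTensor (F.obj X) t) = TensorProduct.rid k (F.obj X)
      (LinearMap.lTensor (F.obj X) (Functor.LaxMonoidal.μ F D X ≫ F.map (ε_ X D) ≫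
        Functor.OplaxMonoidal.η F).hom (TensorProduct.assoc k _ _ _ (t ⊗ₜ[k] x))) := by
    induction t with
    | zero => simp
    | tmul a b => rfl
    | add a b ha hb => simp only [TensorProduct.add_tmul, map_add, ha, hb]
  exact key _

lemma coevElt_right (s : F.obj D) : TensorProduct.lid k (F.obj D)
    ((pairing F X D s).rTensor (F.obj D) (coevElt F X D)) = s := by
  have h : (ρ_ (F.obj D)).inv ≫ F.obj D ◁ (Functor.LaxMonoidal.ε F ≫ F.map (η_ X D) ≫
      Functor.OplaxMonoidal.δ F X D) ≫ (α_ _ _ _).inv ≫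
      (Functor.LaxMonoidal.μ F D X ≫ F.map (ε_ X D) ≫ Functor.OplaxMonoidal.η F) ▷ F.obj D ≫
        (λ_ (F.obj D)).hom = 𝟙 _ := by
    have e := congrArg (fun t => F.map ((ρ_ D).inv ≫ t ≫ (λ_ D).hom))
      (ExactPairing.coevaluation_evaluation X D)
    simp only [Functor.map_comp, map_whiskerLeft, map_whiskerRight, map_associator_inv,
      map_leftUnitor, map_rightUnitor_inv, Category.assoc, μ_δ_assoc, Category.comp_id,
      Iso.inv_hom_id, CategoryTheory.Functor.map_id] at e
    simpa only [comp_whiskerRight, whiskerLeft_comp, Category.assoc] using e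
  have e := congrArg (fun t => t.hom s) h
  refine Eq.trans ?_ e
  have key (t : F.obj X ⊗[k] F.obj D) : TensorProduct.lid k (F.obj D)
      ((pairing F X D s).rTensor (F.obj D) t) = TensorProduct.lid k (F.obj D)
      (LinearMap.rTensor (F.obj D) (Functor.LaxMonoidal.μ F D X ≫ F.map (ε_ X D) ≫
        Functor.OplaxMonoidal.η F).hom ((TensorProduct.assoc k _ _ _).symm (s ⊗ₜ[k] t))) := by
    induction t with
    | zero => simp
    | tmul a b => rfl
    | add a b ha hb => simp only [TensorProduct.tmul_add, map_add, ha, hb]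
  exact key _

end

variable [BraidedCategory C] {X D : C} [HopfObj X] [HopfObj D] [ExactPairing X D]

lemma pairing_one (h : IsHopfDual X D) (s : F.obj D) :
    pairing F X D s (oneElt F X) = counitLin F D s := by
  have e : (ρ_ (F.obj D)).inv ≫ F.obj D ◁ (Functor.LaxMonoidal.ε F ≫ F.map η[X]) ≫
      Functor.LaxMonoidal.μ F D X ≫ F.map (ε_ X D) ≫ Functor.OplaxMonoidal.η F =
      F.map ε[D] ≫ Functor.OplaxMonoidal.η F := by
    have e := congrArg (fun t => F.map ((ρ_ D).inv ≫ t) ≫ Functor.OplaxMonoidal.η F) h.pair_one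
    simp only [Functor.map_comp, map_whiskerLeft, map_rightUnitor_inv, Category.assoc, μ_δ_assoc,
      Iso.inv_hom_id_assoc] at e
    simpa only [comp_whiskerRight, whiskerLeft_comp, Category.assoc] using e
  exact congrArg (fun t => t.hom s) e

lemma one_pairing (h : IsHopfDual X D) (x : F.obj X) :
    pairing F X D (oneElt F D) x = counitLin F X x := by
  have e : (λ_ (F.obj X)).inv ≫ (Functor.LaxMonoidal.ε F ≫ F.map η[D]) ▷ F.obj X ≫
      Functor.LaxMonoidal.μ F D X ≫ F.map (ε_ X D) ≫ Functor.OplaxMonoidal.η F =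
      F.map ε[X] ≫ Functor.OplaxMonoidal.η F := by
    have e := congrArg (fun t => F.map ((λ_ X).inv ≫ t) ≫ Functor.OplaxMonoidal.η F) h.one_pair
    simp only [Functor.map_comp, map_whiskerRight, map_leftUnitor_inv, Category.assoc, μ_δ_assoc,
      Iso.inv_hom_id_assoc] at e
    simpa only [comp_whiskerRight, whiskerLeft_comp, Category.assoc] using e
  exact congrArg (fun t => t.hom x) e

lemma pairing_mul (h : IsHopfDual X D) (s : F.obj D) (x y : F.obj X) :
    pairing F X D s (bilin F μ[X] x y) = pairing F X D (TensorProduct.lid k (F.obj D)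
      (((pairing F X D).flip y).rTensor (F.obj D) (comulLin F D s))) x := by
  have e : F.obj D ◁ (Functor.LaxMonoidal.μ F X X ≫ F.map μ[X]) ≫ Functor.LaxMonoidal.μ F D X ≫
      F.map (ε_ X D) ≫ Functor.OplaxMonoidal.η F =
      (F.map Δ[D] ≫ Functor.OplaxMonoidal.δ F D D) ▷ (F.obj X ⊗ F.obj X) ≫ (α_ _ _ _).hom ≫
      F.obj D ◁ (α_ _ _ _).inv ≫ F.obj D ◁ ((Functor.LaxMonoidal.μ F D X ≫
      F.map (ε_ X D) ≫ Functor.OplaxMonoidal.η F) ▷ F.obj X) ≫ F.obj D ◁ (λ_ (F.obj X)).hom ≫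
      Functor.LaxMonoidal.μ F D X ≫ F.map (ε_ X D) ≫ Functor.OplaxMonoidal.η F := by
    have e := congrArg (fun t => F.obj D ◁ Functor.LaxMonoidal.μ F X X ≫
      Functor.LaxMonoidal.μ F D (X ⊗ X) ≫ F.map t ≫ Functor.OplaxMonoidal.η F) h.pair_mul
    simp only [nestedEval, Functor.map_comp, map_whiskerLeft, map_whiskerRight, map_associator,
      map_associator_inv, map_leftUnitor, Category.assoc, μ_δ_assoc, comp_whiskerRight,
      whiskerLeft_comp, whiskerLeft_μ_δ_assoc] at e ⊢
    rw [e, whisker_exchange_assoc, whisker_exchange_assoc, associator_naturality_right_assoc,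
      ← whiskerLeft_comp_assoc (F.obj D) (F.obj D ◁ _), ← whiskerLeft_comp (F.obj D), μ_δ,
      whiskerLeft_id, whiskerLeft_id, Category.id_comp]
  have e := congrArg (fun t => t.hom (s ⊗ₜ[k] (x ⊗ₜ[k] y))) e
  refine Eq.trans ?_ (e.trans ?_)
  · rfl
  have key (t : F.obj D ⊗[k] F.obj D) : ((α_ _ _ _).hom ≫
      F.obj D ◁ (α_ _ _ _).inv ≫ F.obj D ◁ ((Functor.LaxMonoidal.μ F D X ≫
      F.map (ε_ X D) ≫ Functor.OplaxMonoidal.η F) ▷ F.obj X) ≫ F.obj D ◁ (λ_ (F.obj X)).hom ≫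
      Functor.LaxMonoidal.μ F D X ≫ F.map (ε_ X D) ≫ Functor.OplaxMonoidal.η F).hom
      (t ⊗ₜ[k] (x ⊗ₜ[k] y)) = pairing F X D (TensorProduct.lid k (F.obj D)
      (((pairing F X D).flip y).rTensor (F.obj D) t)) x := by
    induction t with
    | zero => simp
    | tmul a b =>
      change pairing F X D a (pairing F X D b x • y) = pairing F X D (pairing F X D a y • b) x
      simp [mul_comm]
    | add a b ha hb => simp only [TensorProduct.add_tmul, map_add, ha, hb, LinearMap.add_apply]
  exact key _

end Linear

/-! ### Rank of a linear map from a dimension count -/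

section Rank

variable {k V W : Type*} [Field k] [AddCommGroup V] [Module k V] [AddCommGroup W] [Module k W]

/-- Factor φ through its range: tensoring keeps the first map surjective and, by flatness, the
second injective. -/
lemma finrank_range_lTensor (φ : V →ₗ[k] V) :
    Module.finrank k (LinearMap.range (φ.lTensor W)) =
      Module.finrank k W * Module.finrank k (LinearMap.range φ) := by
  have h₁ : φ.lTensor W = (LinearMap.range φ).subtype.lTensor W ∘ₗ φ.rangeRestrict.lTensor W := by
    rw [← LinearMap.lTensor_comp, LinearMap.subtype_comp_codRestrict]
  have h₂ : LinearMap.range (φ.rangeRestrict.lTensor W) = ⊤ :=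
    LinearMap.range_eq_top.2 (LinearMap.lTensor_surjective W φ.surjective_rangeRestrict)
  have h₃ : Function.Injective ((LinearMap.range φ).subtype.lTensor W) :=
    Module.Flat.lTensor_preserves_injective_linearMap _ (Submodule.subtype_injective _)
  rw [h₁, LinearMap.range_comp_of_range_eq_top _ h₂, LinearMap.finrank_range_of_inj h₃,
    Module.finrank_tensorProduct]

/-- If `φ` tensored with a space of the dimension of `V` splits `V`, then `φ` has rank one. -/
lemma finrank_range_eq_one {φ : V →ₗ[k] V} {a : W ⊗[k] V →ₗ[k] V} {θ : V →ₗ[k] W ⊗[k] V}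
    (hV : 0 < Module.finrank k V) (hW : Module.finrank k W = Module.finrank k V)
    (h₁ : ∀ x, a (φ.lTensor W (θ x)) = x)
    (h₂ : ∀ t, φ.lTensor W (θ (a (φ.lTensor W t))) = φ.lTensor W t) :
    Module.finrank k (LinearMap.range φ) = 1 := by
  -- The equivalence is (1 ⊗ φ) ∘ θ, injective by `h₁` and surjective by `h₂`. It gives dim V = dim
  -- V · rank φ, and dim V > 0 cancels.
  have e : V ≃ₗ[k] LinearMap.range (φ.lTensor W) :=
    LinearEquiv.ofBijective ((φ.lTensor W ∘ₗ θ).codRestrict (LinearMap.range (φ.lTensor W))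
      fun x => LinearMap.mem_range_self _ (θ x)) <| by
      refine ⟨fun x y hxy => ?_, fun ⟨_, t, ht⟩ => ⟨a (φ.lTensor W t), Subtype.ext ?_⟩⟩
      · have hxy : φ.lTensor W (θ x) = φ.lTensor W (θ y) := congrArg Subtype.val hxy
        rw [← h₁ x, hxy, h₁]
      · exact (h₂ t).trans ht
  have h := e.finrank_eq
  rw [finrank_range_lTensor, hW] at h
  exact (Nat.eq_of_mul_eq_mul_left hV (by rw [← h, mul_one])).symm

end Rank

/-! ### Finite dimensionality, nondegeneracy, and the rank of the integral -/

section

variable {k : Type u} [Field k] {C : Type w} [Category.{v} C] [MonoidalCategory C]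
  (F : C ⥤ ModuleCat.{u} k) [F.Monoidal] {X D : C} [ExactPairing X D]

lemma eq_of_pairing_left {x y : F.obj X} (h : ∀ s, pairing F X D s x = pairing F X D s y) :
    x = y := by
  rw [← coevElt_left F X D x, ← coevElt_left F X D y,
    show (pairing F X D).flip x = (pairing F X D).flip y from LinearMap.ext h]

lemma eq_of_pairing_right {s t : F.obj D} (h : ∀ x, pairing F X D s x = pairing F X D t x) :
    s = t := by
  rw [← coevElt_right F X D s, ← coevElt_right F X D t,
    show pairing F X D s = pairing F X D t from LinearMap.ext h]

/-- The first legs of a finite expression for the canonical element span, by `coevElt_left`. -/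
lemma finite_left (X D : C) [ExactPairing X D] : Module.Finite k (F.obj X) := by
  obtain ⟨s, hs⟩ := TensorProduct.exists_finset (coevElt F X D)
  classical
  refine ⟨⟨s.image Prod.fst, ?_⟩⟩
  rw [eq_top_iff]
  rintro x -
  rw [← coevElt_left F X D x, hs, map_sum, map_sum]
  refine Submodule.sum_mem _ fun i hi => ?_
  rw [LinearMap.lTensor_tmul, TensorProduct.rid_tmul]
  exact Submodule.smul_mem _ _ (Submodule.subset_span (by simpa using ⟨_, hi⟩))

/-- The dual object has the dual vector space as its underlying space. -/
noncomputable def dualEquiv (X D : C) [ExactPairing X D] :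
     F.obj D ≃ₗ[k] Module.Dual k (F.obj X) :=
  LinearEquiv.ofBijective (pairing F X D) <| by
    refine ⟨fun s t h => eq_of_pairing_right F fun x => LinearMap.congr_fun h x, fun f =>
      ⟨TensorProduct.lid k _ (f.rTensor (F.obj D) (coevElt F X D)), LinearMap.ext fun x => ?_⟩⟩
    have key (t : F.obj X ⊗[k] F.obj D) :
        pairing F X D (TensorProduct.lid k _ (f.rTensor (F.obj D) t)) x =
          f (TensorProduct.rid k _ (((pairing F X D).flip x).lTensor (F.obj X) t)) := by
      induction t with
      | zero => simp
      | tmul a b => simp [mul_comm]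
      | add a b ha hb => simp only [map_add, ha, hb, LinearMap.add_apply]
    rw [key, coevElt_left]

lemma finrank_dual (X D : C) [ExactPairing X D] :
    Module.finrank k (F.obj D) = Module.finrank k (F.obj X) :=
  (dualEquiv F X D).finrank_eq.trans Subspace.dual_finrank_eq

lemma counitLin_oneElt (X : C) [BraidedCategory C] [HopfObj X] :
    counitLin F X (oneElt F X) = 1 := by
  have e : (Functor.LaxMonoidal.ε F ≫ F.map η[X]) ≫ F.map ε[X] ≫ Functor.OplaxMonoidal.η F =
      𝟙 _ := by
    rw [Category.assoc, ← F.map_comp_assoc, BimonObj.one_counit, CategoryTheory.Functor.map_id,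
      Category.id_comp, Functor.Monoidal.ε_η]
  exact congrArg (fun t => t.hom (1 : k)) e

lemma finrank_pos (X D : C) [ExactPairing X D] [BraidedCategory C] [HopfObj X] :
    0 < Module.finrank k (F.obj X) := by
  have := finite_left F X D
  have : Nontrivial (F.obj X) := ⟨oneElt F X, 0, fun h => by
    simpa [h] using counitLin_oneElt F X⟩
  exact Module.finrank_pos

end

section

variable {k : Type u} [Field k] {C : Type w} [Category.{v} C] [MonoidalCategory C]
  [BraidedCategory C] (F : C ⥤ ModuleCat.{u} k) [F.Monoidal]
  {X D : C} [HopfObj X] [HopfObj D] [ExactPairing X D] [IsIso 𝒮[D]]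

lemma finrank_range_braidedIntegral (h : IsHopfDual X D) :
    Module.finrank k (LinearMap.range (F.map (braidedIntegral X D)).hom) = 1 := by
  obtain ⟨θ, h₁, h₂⟩ := exists_section h
  have e₁ : (F.map θ ≫ Functor.OplaxMonoidal.δ F D X) ≫ F.obj D ◁ F.map (braidedIntegral X D) ≫
      Functor.LaxMonoidal.μ F D X ≫ F.map (action X D) = 𝟙 _ := by
    have := congrArg F.map h₁
    simpa using this
  have e₂ : F.obj D ◁ F.map (braidedIntegral X D) ≫ (Functor.LaxMonoidal.μ F D X ≫
      F.map (action X D)) ≫ (F.map θ ≫ Functor.OplaxMonoidal.δ F D X) ≫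
      F.obj D ◁ F.map (braidedIntegral X D) = F.obj D ◁ F.map (braidedIntegral X D) := by
    have := congrArg (fun t => Functor.LaxMonoidal.μ F D X ≫ F.map t ≫
      Functor.OplaxMonoidal.δ F D X) h₂
    simpa only [Functor.map_comp, Functor.Monoidal.map_whiskerLeft, Category.assoc,
      Functor.Monoidal.μ_δ, Functor.Monoidal.μ_δ_assoc, Category.comp_id] using this
  exact finrank_range_eq_one (finrank_pos F X D) (finrank_dual F X D)
    (fun x => congrArg (fun t => t.hom x) e₁) (fun t => congrArg (fun f => f.hom t) e₂)

end

end BraidedIntegral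

open BraidedIntegral in
theorem lemma6 {k : Type u} [Field k] {C : Type w} [Category.{v} C] [MonoidalCategory C]
    [BraidedCategory C] (F : C ⥤ ModuleCat.{u} k) [F.Monoidal]
    (X D : C) [HopfObj X] [HopfObj D] [ExactPairing X D]
    (hXD : BraidedIntegral.IsHopfDual X D) [IsIso 𝒮[D]] :
    F.map (BraidedIntegral.braidedIntegral X D) ≠ 0 ∧
    ∃ (R : F.obj D →ₗ[k] k) (δ : F.obj X) (L : F.obj X →ₗ[k] k),
      BraidedIntegral.IsRightDelta F X D R δ ∧
      BraidedIntegral.IsLeftIntegral F X L ∧ L ≠ 0 ∧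
      ∀ x : F.obj X, (F.map (BraidedIntegral.braidedIntegral X D)).hom x = L x • δ := by
  have hr := finrank_range_braidedIntegral F hXD
  obtain ⟨⟨δ, y, hy⟩, hδ, hspan⟩ := finrank_eq_one_iff'.1 hr
  have hδ : δ ≠ 0 := fun h => hδ (Subtype.ext h)
  obtain ⟨s, hs⟩ : ∃ s, pairing F X D s δ ≠ 0 := by
    by_contra! h
    exact hδ (eq_of_pairing_left F fun s => by rw [h, map_zero])
  -- The coefficient along δ is read off by pairing with `s`, which makes L visibly linear.
  have hI (x : F.obj X) : (F.map (braidedIntegral X D)).hom x =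
      ((pairing F X D s δ)⁻¹ • (pairing F X D s ∘ₗ (F.map (braidedIntegral X D)).hom)) x • δ := by
    obtain ⟨c, hc⟩ := hspan ⟨_, x, rfl⟩
    have hc : c • δ = (F.map (braidedIntegral X D)).hom x := congrArg Subtype.val hc
    rw [LinearMap.smul_apply, LinearMap.comp_apply, ← hc, map_smul, smul_eq_mul, smul_eq_mul,
      mul_left_comm, inv_mul_cancel₀ hs, mul_one]
  set L := (pairing F X D s δ)⁻¹ • (pairing F X D s ∘ₗ (F.map (braidedIntegral X D)).hom)
  refine ⟨fun h => hδ ?_, (pairing F X D).flip δ, δ, L, ⟨fun t => ?_, fun h => ?_, fun t => rfl⟩,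
    fun x => ?_, fun h => hδ ?_, hI⟩
  · rw [← hy, h]
    rfl
  -- Paired with x, R(t₍₁₎)t₍₂₎ gives ⟨t, xδ⟩, which is ε(x)⟨t, δ⟩ because δ is a value of `I`.
  · refine eq_of_pairing_right F (X := X) fun x => ?_
    rw [← pairing_mul F hXD, map_smul, LinearMap.smul_apply, one_pairing F hXD, ← hy,
      ← bilin_whiskerLeft, whiskerLeft_braidedIntegral_mul hXD, bilin_counit, map_smul,
      LinearMap.flip_apply, smul_eq_mul, smul_eq_mul, mul_comm]
  · exact hs (LinearMap.congr_fun h s)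
  -- Paired with t, x₍₁₎L(x₍₂₎) gives L(t ▷ x), which is ε(t)L(x) by invariance of `I` under the
  -- action.
  · refine eq_of_pairing_left F (D := D) fun t => ?_
    have key (z : F.obj X ⊗[k] F.obj X) :
        pairing F X D t (TensorProduct.rid k _ (L.lTensor (F.obj X) z)) =
          L (TensorProduct.lid k _ ((pairing F X D t).rTensor (F.obj X) z)) := by
      induction z with
      | zero => simp
      | tmul a b => simp [mul_comm]
      | add a b ha hb => simp only [map_add, ha, hb]
    have hL : L (bilin F (action X D) t x) = counitLin F D t * L x := by
      have e := bilin_comp F (action X D) (braidedIntegral X D) t x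
      rw [action_comp_braidedIntegral hXD, bilin_counit, hI, hI, smul_smul] at e
      exact (smul_left_injective k hδ e).symm
    rw [key, ← bilin_action, hL, map_smul, pairing_one F hXD, smul_eq_mul, mul_comm]
  · rw [← hy, hI, h, LinearMap.zero_apply, zero_smul]
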